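/- **Setting.** Let $(\mathbb X,\rho)$ be a connected metric space whose closed balls $\mathbb B(x,r)=\{y:\rho(x,y)\le r\}$, $r>0$, are compact, let $\mu^*$ be a positive sigma-finite Borel measure on $\mathbb X$, let $0=\lambda_0\le\lambda_1\le\cdots$ with $\lambda_k\to\infty$, and let $\{\phi_k\}_{k\ge 0}\subset L^1(\mu^*)\cap C_0(\mathbb X)$ be real-valued and orthonormal in $L^2(\mu^*)$, with $\phi_0>0$ everywhere and linear span dense in $C_0(\mathbb X)$. Put $\Pi_n=\operatorname{span}\{\phi_k:\lambda_k<n\}$. Assume that this is a *data space*: there are $q\ge1$ and $\kappa,\kappa_1,\kappa_2>0$ with $\mu^*(\mathbb B(x,r))=\mu^*(\{y:\rho(x,y)<r\})\le\kappa r^q$ for all $x\in\mathbb X$, $r>0$; for all $x,y\in\mathbb X$ and $0<t\le1$ the series $\sum_k e^{-\lambda_k^2t}\phi_k(x)\phi_k(y)$ converges absolutely and $$\Big|\sum_k e^{-\lambda_k^2t}\phi_k(x)\phi_k(y)\Big|\le\kappa_1t^{-q/2}\exp\big(-\kappa_2\rho(x,y)^2/t\big);$$ and there are compact sets $\mathbb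 K_n$, $n=1,2,\dots$, whose diameters grow at most polynomially in $n$, such that $\sup_{x\notin\mathbb K_n}\sum_{\lambda_k<n}\phi_k(x)^2$ and $\int_{\mathbb X\setminus\mathbb K_n}\big(\sum_{\lambda_k<n}\phi_k^2\big)^{1/2}d\mu^*$ are fast decreasing in $n$ ($a_n$ is fast decreasing if $n^Sa_n\to0$ for every $S>0$). **Smoothness classes.** For $1\le p\le\infty$, $\gamma>0$ and a weight $w$ (here $w\equiv1$, then omitted from the notation, or $w=\phi_0$), let $E_n(w;p,f)=\inf_{P\in\Pi_n}\|f-Pw\|_{p,\mu^*}$, let $X^p=\{f\in L^p:E_n(p,f)\to0\}$, and let $W_{\gamma,p,w}$ be the set of $f\in L^p$ with $\|f\|_{p,\mu^*}+\sup_{n>0}n^\gamma E_n(w;p,f)<\infty$. Let $C^\infty=\bigcap_{\gamma>0}W_{\gamma,\infty}$. For $x_0\in\mathbb X$, $f\in W_{\gamma,p,w}(x_0)$ means that there is $r>0$ such that $\psi f\in W_{\gamma,p,w}$ for every $\psi\in C^\infty$ supported on $\mathbb B(x_0,r)$. **Assumptions.** *Partition of unity:* for every $r>0$ there are $\psi_0,\psi_1,\ldots\in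 C^\infty$ with values in $[0,1]$, each supported on some ball of radius $r$, such that for every $x\in\mathbb X$ finitely many of them sum to $1$ on $\mathbb B(x,r)$. *Product assumption:* there are $A^*\ge1$ and $R_{j,k,n}\in\Pi_{A^*n}$ such that $\max_{\lambda_j,\lambda_k<n,\;p\in\{1,\infty\}}\|\phi_k\phi_j-R_{j,k,n}\phi_0\|_{p,\mu^*}$ is fast decreasing in $n$. **Operators.** Let $h:\mathbb R\to[0,1]$ be even, infinitely differentiable, non-increasing on $[0,\infty)$, with $h(t)=1$ for $|t|\le1/2$ and $h(t)=0$ for $t\ge1$. Put $$\sigma_n(f)=\sum_kh(\lambda_k/n)\Big(\int f\phi_k\,d\mu^*\Big)\phi_k,\qquad \tau_0(f)=\sigma_1(f),\qquad \tau_j(f)=\sigma_{2^j}(f)-\sigma_{2^{j-1}}(f)\quad(j\ge1).$$ Write $\|g\|_{p,\mu^*,\mathbb B}$ for the $L^p(\mu^*)$ norm over $\mathbb B$, and $A\sim B$ for $c_1A\le B\le c_2A$ (for quantities in $[0,\infty]$). **Theorem 6.1.** Assume the partition of unity and the product assumption, and let $\gamma>0$. (a) There are constants $c_1,c_2>0$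 such that, with these constants, for all $1\le p\le\infty$, $f\in X^p$, $x_0\in\mathbb X$ and every ball $\mathbb B$ centered at $x_0$, $$\sup_{n\ge0}2^{n\gamma}\|f-\sigma_{2^n}(f)\|_{p,\mu^*,\mathbb B}\ \sim\ \sup_{j\ge1}2^{j\gamma}\|\tau_j(f)\|_{p,\mu^*,\mathbb B},$$ $$\|f\|_{p,\mu^*,\mathbb B}+\sup_{n\ge0}2^{n\gamma}\|f-\sigma_{2^n}(f)\|_{p,\mu^*,\mathbb B}\ \sim\ \sup_{j\ge0}2^{j\gamma}\|\tau_j(f)\|_{p,\mu^*,\mathbb B}.$$ (b) Let $1\le p\le\infty$, $f\in X^p$, $x_0\in\mathbb X$. If for some ball $\mathbb B$ centered at $x_0$ one of $\sup_{n\ge0}2^{n\gamma}\|f-\sigma_{2^n}(f)\|_{p,\mu^*,\mathbb B}$ and $\sup_{j\ge0}2^{j\gamma}\|\tau_j(f)\|_{p,\mu^*,\mathbb B}$ is finite, then $f\in W_{\gamma,p,\phi_0}(x_0)$. (c) Let $1\le p\le\infty$, $f\in X^p$, $x_0\in\mathbb X$. If $f\in W_{\gamma,p}(x_0)$, then there is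 a ball $\mathbb B$ centered at $x_0$ for which both of these suprema are finite. -/

import Mathlib

open MeasureTheory Filter Topology Metric
open scoped ENNReal ZeroAtInfty

noncomputable section

/-- A data space on the metric space `X`: a positive sigma-finite Borel measure `μ`, a non-decreasing
sequence `lam` with `lam 0 = 0` and `lam k → ∞`, and an orthonormal system `φ` of integrable functions
in `C₀(X, ℝ)` with `φ 0 > 0` whose span is dense in `C₀(X, ℝ)`, subject to compactness of balls, the
ball measure condition, the Gaussian upper bound and essential compactness. (Since closed balls are
compact, every continuous function vanishing at infinity is uniformly continuous.) -/
structure DataSpace (X : Type*) [MetricSpace X] [MeasurableSpace X] where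
  μ : Measure X
  sigmaFinite : SigmaFinite μ
  lam : ℕ → ℝ
  lam_mono : Monotone lam
  lam_zero : lam 0 = 0
  lam_tendsto : Tendsto lam atTop atTop
  φ : ℕ → C₀(X, ℝ)
  φ_integrable : ∀ k, Integrable (fun x => φ k x) μ
  φ_orthonormal : ∀ j k, ∫ x, φ j x * φ k x ∂μ = if j = k then 1 else 0
  φ_zero_pos : ∀ x, 0 < φ 0 x
  φ_dense : Dense (Submodule.span ℝ (Set.range φ) : Set C₀(X, ℝ))
  isCompact_closedBall : ∀ (x : X) (r : ℝ), 0 < r → IsCompact (closedBall x r)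
  /-- The ball measure condition and the Gaussian upper bound, with the same exponent `q`. -/
  ball_and_gaussian : ∃ q : ℝ, 1 ≤ q ∧
    (∃ κ : ℝ, 0 < κ ∧ ∀ (x : X) (r : ℝ), 0 < r →
      μ (closedBall x r) = μ (ball x r) ∧ μ (closedBall x r) ≤ ENNReal.ofReal (κ * r ^ q)) ∧
    (∃ κ₁ κ₂ : ℝ, 0 < κ₁ ∧ 0 < κ₂ ∧ ∀ (x y : X) (t : ℝ), 0 < t → t ≤ 1 →
      Summable (fun k => Real.exp (-(lam k) ^ 2 * t) * φ k x * φ k y) ∧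
      |∑' k, Real.exp (-(lam k) ^ 2 * t) * φ k x * φ k y|
        ≤ κ₁ * t ^ (-q / 2) * Real.exp (-κ₂ * (dist x y ^ 2 / t)))
  /-- Essential compactness. The sums over `lam k < n` have finitely many non-zero terms. -/
  essentially_compact : ∃ K : ℕ → Set X, (∀ n, 1 ≤ n → IsCompact (K n)) ∧
    (∃ c₁ c₂ : ℝ, 0 < c₁ ∧ 0 < c₂ ∧ ∀ n : ℕ, 1 ≤ n → diam (K n) ≤ c₁ * (n : ℝ) ^ c₂) ∧
    (∀ S : ℝ, 0 < S → Tendsto (fun n : ℕ => ENNReal.ofReal ((n : ℝ) ^ S) *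
      ⨆ x ∈ (K n)ᶜ, ENNReal.ofReal (∑' k, if lam k < n then φ k x ^ 2 else 0)) atTop (𝓝 0)) ∧
    (∀ S : ℝ, 0 < S → Tendsto (fun n : ℕ => ENNReal.ofReal ((n : ℝ) ^ S) *
      ∫⁻ x in (K n)ᶜ, ENNReal.ofReal (√(∑' k, if lam k < n then φ k x ^ 2 else 0)) ∂μ)
      atTop (𝓝 0))

/-- The low-pass filters used to build the summability operators: even, infinitely differentiable,
`[0, 1]`-valued, non-increasing on `[0, ∞)`, equal to `1` for `|t| ≤ 1/2` and to `0` for `t ≥ 1`. -/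
structure IsLowPass (h : ℝ → ℝ) : Prop where
  contDiff : ContDiff ℝ ((⊤ : ℕ∞) : WithTop ℕ∞) h
  mem_Icc : ∀ t, h t ∈ Set.Icc (0 : ℝ) 1
  even : ∀ t, h (-t) = h t
  antitone : AntitoneOn h (Set.Ici 0)
  eq_one : ∀ t, |t| ≤ 1 / 2 → h t = 1
  eq_zero : ∀ t, 1 ≤ t → h t = 0

namespace DataSpace

variable {X : Type*} [MetricSpace X] [MeasurableSpace X]

/-- The diffusion polynomials of order less than `n`: `Π_n = span {φ_k : lam k < n}`
(which is `{0}` for `n ≤ 0`). -/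
def diffPoly (Ξ : DataSpace X) (n : ℝ) : Submodule ℝ (X → ℝ) :=
  Submodule.span ℝ {g | ∃ k, Ξ.lam k < n ∧ g = fun x => Ξ.φ k x}

/-- Degree of approximation `E_n(w; p, f) = inf {‖f - P w‖_p : P ∈ Π_n}`. -/
def degApprox (Ξ : DataSpace X) (w : X → ℝ) (n : ℝ) (p : ℝ≥0∞) (f : X → ℝ) : ℝ≥0∞ :=
  ⨅ P ∈ Ξ.diffPoly n, eLpNorm (fun x => f x - P x * w x) p Ξ.μ

/-- The space `X^p`: the `f ∈ L^p` with `E_n(p, f) → 0`. -/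
def MemXp (Ξ : DataSpace X) (p : ℝ≥0∞) (f : X → ℝ) : Prop :=
  MemLp f p Ξ.μ ∧ Tendsto (fun n : ℝ => Ξ.degApprox (fun _ => 1) n p f) atTop (𝓝 0)

/-- The norm of `W_{γ,p,w}`: `‖f‖_p + sup_{n>0} n^γ E_n(w; p, f)`. -/
def sobolevNorm (Ξ : DataSpace X) (γ : ℝ) (p : ℝ≥0∞) (w : X → ℝ) (f : X → ℝ) : ℝ≥0∞ :=
  eLpNorm f p Ξ.μ + ⨆ (n : ℝ) (_ : 0 < n), ENNReal.ofReal (n ^ γ) * Ξ.degApprox w n p f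

/-- Membership in the smoothness class `W_{γ,p,w}`. -/
def MemSobolev (Ξ : DataSpace X) (γ : ℝ) (p : ℝ≥0∞) (w : X → ℝ) (f : X → ℝ) : Prop :=
  MemLp f p Ξ.μ ∧ Ξ.sobolevNorm γ p w f < ⊤

/-- The class `C^∞ = ⋂_{γ>0} W_{γ,∞}` (weight `1`). -/
def MemSmooth (Ξ : DataSpace X) (f : X → ℝ) : Prop :=
  ∀ γ : ℝ, 0 < γ → Ξ.MemSobolev γ ⊤ (fun _ => 1) f

/-- The class `C^∞(B)`: the members of `C^∞` that are supported on `B`. -/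
def MemSmoothOn (Ξ : DataSpace X) (B : Set X) (f : X → ℝ) : Prop :=
  Ξ.MemSmooth f ∧ ∀ x, x ∉ B → f x = 0

/-- The local smoothness class `W_{γ,p,w}(x₀)`: for some `r > 0`, multiplication by any `C^∞` function
supported on the closed ball `B(x₀, r)` takes `f` into `W_{γ,p,w}`. -/
def MemLocalSobolev (Ξ : DataSpace X) (γ : ℝ) (p : ℝ≥0∞) (w : X → ℝ) (x₀ : X) (f : X → ℝ) : Prop :=
  ∃ r : ℝ, 0 < r ∧ ∀ ψ : X → ℝ, Ξ.MemSmoothOn (closedBall x₀ r) ψ →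
    Ξ.MemSobolev γ p w (fun x => ψ x * f x)

/-- Partition of unity: for every `r > 0` there is a sequence of `C^∞` functions with values in
`[0, 1]`, each supported on a ball of radius `r`, such that for every `x` finitely many of them
sum to `1` on `B(x, r)`. -/
def PartitionOfUnityAssumption (Ξ : DataSpace X) : Prop :=
  ∀ r : ℝ, 0 < r → ∃ ψ : ℕ → X → ℝ,
    (∀ k, ∃ y : X, Ξ.MemSmoothOn (closedBall y r) (ψ k)) ∧
    (∀ k x, ψ k x ∈ Set.Icc (0 : ℝ) 1) ∧
    (∀ x : X, ∃ F : Finset ℕ, ∀ y ∈ closedBall x r, ∑ k ∈ F, ψ k y = 1)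

/-- Product assumption: there are `A ≥ 1` and `R_{j,k,n} ∈ Π_{A n}` such that
`max {‖φ_k φ_j - R_{j,k,n} φ_0‖_p : lam k < n, lam j < n, p = 1, ∞}` is fast decreasing in `n`. -/
def ProductAssumption (Ξ : DataSpace X) : Prop :=
  ∃ A : ℝ, 1 ≤ A ∧ ∃ R : ℕ → ℕ → ℕ → X → ℝ,
    (∀ j k n : ℕ, R j k n ∈ Ξ.diffPoly (A * n)) ∧
    ∀ S : ℝ, 0 < S → Tendsto (fun n : ℕ => ENNReal.ofReal ((n : ℝ) ^ S) *
      ⨆ (j : ℕ) (k : ℕ) (_ : Ξ.lam j < n) (_ : Ξ.lam k < n),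
        max (eLpNorm (fun x => Ξ.φ k x * Ξ.φ j x - R j k n x * Ξ.φ 0 x) 1 Ξ.μ)
          (eLpNorm (fun x => Ξ.φ k x * Ξ.φ j x - R j k n x * Ξ.φ 0 x) ⊤ Ξ.μ)) atTop (𝓝 0)

/-- The coefficient `∫ f φ_k dμ`. -/
def coeff (Ξ : DataSpace X) (f : X → ℝ) (k : ℕ) : ℝ :=
  ∫ y, f y * Ξ.φ k y ∂Ξ.μ

/-- `σ_n(f) = ∑_k h(lam k / n) (∫ f φ_k dμ) φ_k`, a finite sum for `n > 0` and `h` low-pass. -/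
def sigma (Ξ : DataSpace X) (h : ℝ → ℝ) (n : ℝ) (f : X → ℝ) (x : X) : ℝ :=
  ∑' k, h (Ξ.lam k / n) * Ξ.coeff f k * Ξ.φ k x

/-- `τ_0(f) = σ_1(f)` and `τ_j(f) = σ_{2^j}(f) - σ_{2^(j-1)}(f)` for `j ≥ 1`. -/
def tau (Ξ : DataSpace X) (h : ℝ → ℝ) : ℕ → (X → ℝ) → X → ℝ
  | 0, f, x => Ξ.sigma h 1 f x
  | j + 1, f, x => Ξ.sigma h (2 ^ (j + 1)) f x - Ξ.sigma h (2 ^ j) f x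

/-- The local norm `‖f‖_{p,μ,B}`. -/
def normOn (Ξ : DataSpace X) (p : ℝ≥0∞) (B : Set X) (f : X → ℝ) : ℝ≥0∞ :=
  eLpNorm f p (Ξ.μ.restrict B)

/-- `sup_{n ≥ 0} 2^{nγ} ‖f - σ_{2^n}(f)‖_{p,μ,B}`. -/
def errorRate (Ξ : DataSpace X) (h : ℝ → ℝ) (γ : ℝ) (p : ℝ≥0∞) (B : Set X) (f : X → ℝ) : ℝ≥0∞ :=
  ⨆ n : ℕ, ENNReal.ofReal ((2 : ℝ) ^ ((n : ℝ) * γ)) *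
    Ξ.normOn p B (fun x => f x - Ξ.sigma h (2 ^ n) f x)

/-- `sup_{j ≥ j₀} 2^{jγ} ‖τ_j(f)‖_{p,μ,B}`. -/
def tauRate (Ξ : DataSpace X) (h : ℝ → ℝ) (γ : ℝ) (p : ℝ≥0∞) (B : Set X) (j₀ : ℕ) (f : X → ℝ) :
    ℝ≥0∞ :=
  ⨆ (j : ℕ) (_ : j₀ ≤ j), ENNReal.ofReal ((2 : ℝ) ^ ((j : ℝ) * γ)) *
    Ξ.normOn p B (Ξ.tau h j f)

end DataSpace

end

/-! Everything rests on the localization of the kernel `∑ h(λ_k / n) φ_k(x) φ_k(y)`: for every `T`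
it is at most `C n^q (1 + n ρ(x, y))^(-T)` (`exists_kernel_localized`). To derive this from the
Gaussian bound alone, write `h(t)` in the variable `v = exp(-t²)`. Since `h` vanishes for large `t`
and is `1` near `0`, the profile divided by `v` is smooth, so `h` is an integral of the functions `v
exp(2πiξv)` against a rapidly decreasing density (`exists_fourier_representation`). With `t = λ_k /
n` this superposes the kernels `expKernel` with imaginary parameter `z`.

Each such kernel has two bounds. As `|exp(zv)| = 1`, it is at most `κ₁ n^q`, whatever `z` is.
Expanding `exp(zv)` in powers of `v` produces heat kernels at the times `(j + 1) / n²`, which the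
semigroup property localizes at the cost of a factor `C^(j + 1)` (`abs_heat_iterate_le`); summing
gives `C n^q exp(C|z| - nρ)`. Combining the two gives polynomial decay in `nρ` with only polynomial
growth in `ξ`, which the density absorbs.

Schur's test then shows that the operators `σ_n` are uniformly bounded on every `L^p`, and that data
at distance `δ` contribute only `O((nδ)^(-S))`. As `σ_n` reproduces `Π_{n/2}`, it is near-best
(`exists_eLpNorm_sub_sigma_le`).

The equivalence of the two rates is telescoping, using `σ_{2^n} f → f` for `f` in `X^p`. For local
smoothness implying rates, take a cutoff `ψ` equal to `1` near `x₀`: the product `ψf` is globally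
smooth, and `(1 - ψ)f` is far from the smaller ball. For the converse, with `σ = σ_{2^j}`, split `ψf
- Pφ_0` into `ψ(f - σf)`, `(ψ - σψ)σf` and `σψ σf - Pφ_0`. These are controlled by the local rate,
by the smoothness of `ψ`, and by the product assumption. The last estimate also needs the dimension
of `Π_n` and the norms of the `φ_k` to grow polynomially (`exists_polynomial_bounds`). -/

noncomputable section

/-! ### Integral inequalities: Jensen, Schur, interpolation. -/

/-- Jensen's inequality for the weight `K`. -/
theorem lintegral_mul_rpow_le {α : Type*} [MeasurableSpace α] {μ : Measure α} {K F : α → ℝ≥0∞}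
    (hK : AEMeasurable K μ) (hF : AEMeasurable F μ) {p : ℝ} (hp : 1 ≤ p) :
    (∫⁻ y, K y * F y ∂μ) ^ p ≤ (∫⁻ y, K y ∂μ) ^ (p - 1) * ∫⁻ y, K y * F y ^ p ∂μ := by
  rcases hp.eq_or_lt with rfl | hp
  · simp
  have hpq := Real.HolderConjugate.conjExponent hp
  set q := Real.conjExponent p
  have hp0 : 0 < p := hpq.pos
  have hq0 : 0 < q := hpq.symm.pos
  -- Hölder is applied to `K F = (K^(1/p) F) · K^(1/q)`, so that the weight survives in both
  -- factors.
  have h1 : ∀ y, K y * F y = ((fun y => K y ^ (1 / p) * F y) * fun y => K y ^ (1 / q)) y := by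
    intro y
    have : K y = K y ^ (1 / p) * K y ^ (1 / q) := by
      rw [← ENNReal.rpow_add_of_nonneg _ _ (by positivity) (by positivity)]
      have : 1 / p + 1 / q = 1 := by simpa using hpq.inv_add_inv_eq_one
      rw [this, ENNReal.rpow_one]
    simp only [Pi.mul_apply]
    nth_rw 1 [this]
    ring
  have h2 := ENNReal.lintegral_mul_le_Lp_mul_Lq μ hpq
    (f := fun y => K y ^ (1 / p) * F y) (g := fun y => K y ^ (1 / q))
    ((hK.pow_const _).mul hF) (hK.pow_const _)
  simp_rw [← h1] at h2
  have h3 : ∀ y, (K y ^ (1 / p) * F y) ^ p = K y * F y ^ p := by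
    intro y
    rw [ENNReal.mul_rpow_of_nonneg _ _ hp0.le, ← ENNReal.rpow_mul, one_div_mul_cancel hp0.ne',
      ENNReal.rpow_one]
  have h4 : ∀ y, (K y ^ (1 / q)) ^ q = K y := by
    intro y
    rw [← ENNReal.rpow_mul, one_div_mul_cancel hq0.ne', ENNReal.rpow_one]
  simp_rw [h3, h4] at h2
  calc (∫⁻ y, K y * F y ∂μ) ^ p
      ≤ ((∫⁻ y, K y * F y ^ p ∂μ) ^ (1 / p) * (∫⁻ y, K y ∂μ) ^ (1 / q)) ^ p :=
        ENNReal.rpow_le_rpow h2 hp0.le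
    _ = _ := by
        rw [ENNReal.mul_rpow_of_nonneg _ _ hp0.le, ← ENNReal.rpow_mul, one_div_mul_cancel hp0.ne',
          ENNReal.rpow_one, ← ENNReal.rpow_mul, mul_comm]
        congr 2
        have : 1 / q = 1 - 1 / p := by
          have := hpq.inv_add_inv_eq_one
          simp only [one_div]; linarith
        rw [this]; field_simp

/-- Schur's test. -/
theorem eLpNorm_le_of_kernel {α : Type*} [MeasurableSpace α] {μ : Measure α} [SigmaFinite μ]
    {K : α → α → ℝ≥0∞} (hK : Measurable (Function.uncurry K)) {M : ℝ≥0∞}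
    (h₁ : ∀ x, ∫⁻ y, K x y ∂μ ≤ M) (h₂ : ∀ y, ∫⁻ x, K x y ∂μ ≤ M) {p : ℝ≥0∞} (hp : 1 ≤ p)
    {f g : α → ℝ} (hf : AEStronglyMeasurable f μ)
    (hg : ∀ x, ‖g x‖ₑ ≤ ∫⁻ y, K x y * ‖f y‖ₑ ∂μ) :
    eLpNorm g p μ ≤ M * eLpNorm f p μ := by
  have hKm : ∀ x, Measurable (K x) := fun x => hK.comp measurable_prodMk_left
  rcases eq_or_ne p ⊤ with rfl | hpt
  · rw [eLpNorm_exponent_top]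
    refine essSup_le_of_ae_le _ (Eventually.of_forall fun x => (hg x).trans ?_)
    calc ∫⁻ y, K x y * ‖f y‖ₑ ∂μ ≤ ∫⁻ y, K x y * eLpNorm f ⊤ μ ∂μ := by
          refine lintegral_mono_ae ?_
          filter_upwards [ae_le_eLpNormEssSup (f := f) (μ := μ)] with y hy
          rw [eLpNorm_exponent_top]
          gcongr
      _ = (∫⁻ y, K x y ∂μ) * eLpNorm f ⊤ μ := lintegral_mul_const _ (hKm x)
      _ ≤ M * eLpNorm f ⊤ μ := by gcongr; exact h₁ x
  have hp0 : p ≠ 0 := (zero_lt_one.trans_le hp).ne'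
  have hpr : 1 ≤ p.toReal := by
    simpa using (ENNReal.toReal_le_toReal ENNReal.one_ne_top hpt).2 hp
  have hpp : 0 < p.toReal := zero_lt_one.trans_le hpr
  rw [eLpNorm_eq_lintegral_rpow_enorm_toReal hp0 hpt, eLpNorm_eq_lintegral_rpow_enorm_toReal hp0 hpt]
  -- Jensen uses the bound on the integrals in `y` for `p - 1` of the powers of `M`; after Tonelli
  -- the bound on the integrals in `x` supplies the last one.
  have key : ∫⁻ x, ‖g x‖ₑ ^ p.toReal ∂μ ≤ M ^ p.toReal * ∫⁻ x, ‖f x‖ₑ ^ p.toReal ∂μ := by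
    calc ∫⁻ x, ‖g x‖ₑ ^ p.toReal ∂μ
        ≤ ∫⁻ x, M ^ (p.toReal - 1) * ∫⁻ y, K x y * ‖f y‖ₑ ^ p.toReal ∂μ ∂μ := by
          refine lintegral_mono fun x => ?_
          refine (ENNReal.rpow_le_rpow (hg x) hpp.le).trans
            ((lintegral_mul_rpow_le (hKm x).aemeasurable hf.enorm hpr).trans ?_)
          gcongr
          exact h₁ x
      _ ≤ M ^ (p.toReal - 1) * ∫⁻ x, ∫⁻ y, K x y * ‖f y‖ₑ ^ p.toReal ∂μ ∂μ := by
          refine (lintegral_const_mul'' _ ?_).le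
          refine AEMeasurable.lintegral_prod_right'
            (f := fun z : α × α => K z.1 z.2 * ‖f z.2‖ₑ ^ p.toReal) ?_
          exact hK.aemeasurable.mul ((hf.enorm.comp_snd).pow_const _)
      _ = M ^ (p.toReal - 1) * ∫⁻ y, ∫⁻ x, K x y * ‖f y‖ₑ ^ p.toReal ∂μ ∂μ := by
          rw [lintegral_lintegral_swap]
          exact hK.aemeasurable.mul ((hf.enorm.comp_snd).pow_const _)
      _ ≤ M ^ (p.toReal - 1) * ∫⁻ y, M * ‖f y‖ₑ ^ p.toReal ∂μ := by
          gcongr with y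
          rw [lintegral_mul_const (f := fun x => K x y) _ (hK.comp measurable_prodMk_right)]
          gcongr
          exact h₂ y
      _ = M ^ p.toReal * ∫⁻ x, ‖f x‖ₑ ^ p.toReal ∂μ := by
          rw [lintegral_const_mul'' _ (hf.enorm.pow_const _), ← mul_assoc]
          congr 1
          nth_rw 2 [← ENNReal.rpow_one M]
          rw [← ENNReal.rpow_add_of_nonneg _ _ (by linarith) zero_le_one]
          simp
  calc (∫⁻ x, ‖g x‖ₑ ^ p.toReal ∂μ) ^ (1 / p.toReal)
      ≤ (M ^ p.toReal * ∫⁻ x, ‖f x‖ₑ ^ p.toReal ∂μ) ^ (1 / p.toReal) :=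
        ENNReal.rpow_le_rpow key (by positivity)
    _ = _ := by
        rw [ENNReal.mul_rpow_of_nonneg _ _ (by positivity), ← ENNReal.rpow_mul,
          mul_one_div_cancel hpp.ne', ENNReal.rpow_one]

/-- Interpolation between the `L¹` and `L^∞` norms. -/
theorem eLpNorm_le_max_one_top {α : Type*} [MeasurableSpace α] {μ : Measure α} {p : ℝ≥0∞}
    (hp : 1 ≤ p) {g : α → ℝ} (hg : AEStronglyMeasurable g μ) :
    eLpNorm g p μ ≤ max (eLpNorm g 1 μ) (eLpNorm g ⊤ μ) := by
  rcases eq_or_ne p ⊤ with rfl | hpt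
  · exact le_max_right _ _
  set M := max (eLpNorm g 1 μ) (eLpNorm g ⊤ μ) with hM
  have hp0 : p ≠ 0 := (zero_lt_one.trans_le hp).ne'
  have hpr : 1 ≤ p.toReal := by
    simpa using (ENNReal.toReal_le_toReal ENNReal.one_ne_top hpt).2 hp
  have hpp : 0 < p.toReal := zero_lt_one.trans_le hpr
  rw [eLpNorm_eq_lintegral_rpow_enorm_toReal hp0 hpt]
  have key : ∫⁻ x, ‖g x‖ₑ ^ p.toReal ∂μ ≤ M ^ p.toReal := by
    calc ∫⁻ x, ‖g x‖ₑ ^ p.toReal ∂μ ≤ ∫⁻ x, M ^ (p.toReal - 1) * ‖g x‖ₑ ∂μ := by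
          refine lintegral_mono_ae ?_
          filter_upwards [ae_le_eLpNormEssSup (f := g) (μ := μ)] with x hx
          calc ‖g x‖ₑ ^ p.toReal = ‖g x‖ₑ ^ (p.toReal - 1) * ‖g x‖ₑ := by
                nth_rw 3 [← ENNReal.rpow_one ‖g x‖ₑ]
                rw [← ENNReal.rpow_add_of_nonneg _ _ (by linarith) zero_le_one]
                simp
            _ ≤ _ := by
                gcongr
                exact hx.trans ((eLpNorm_exponent_top (f := g) (μ := μ)).symm.le.trans
                    (le_max_right _ _))
      _ = M ^ (p.toReal - 1) * eLpNorm g 1 μ := by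
          rw [lintegral_const_mul'' _ hg.enorm, eLpNorm_one_eq_lintegral_enorm]
      _ ≤ M ^ (p.toReal - 1) * M := by gcongr; exact le_max_left _ _
      _ = M ^ p.toReal := by
          nth_rw 2 [← ENNReal.rpow_one M]
          rw [← ENNReal.rpow_add_of_nonneg _ _ (by linarith) zero_le_one]
          simp
  calc (∫⁻ x, ‖g x‖ₑ ^ p.toReal ∂μ) ^ (1 / p.toReal)
      ≤ (M ^ p.toReal) ^ (1 / p.toReal) := ENNReal.rpow_le_rpow key (by positivity)
    _ = M := by rw [← ENNReal.rpow_mul, mul_one_div_cancel hpp.ne', ENNReal.rpow_one]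

theorem measurable_tsum_of_summable {α : Type*} [MeasurableSpace α] {F : ℕ → α → ℝ}
    (hF : ∀ k, Measurable (F k)) (hs : ∀ x, Summable fun k => F k x) :
    Measurable fun x => ∑' k, F k x := by
  refine measurable_of_tendsto_metrizable (f := fun n x => ∑ k ∈ Finset.range n, F k x)
    (fun n => Finset.measurable_fun_sum _ fun k _ => hF k) ?_
  rw [tendsto_pi_nhds]
  exact fun x => (hs x).hasSum.tendsto_sum_nat

/-- The exponential is dominated by every inverse power. -/
theorem exp_neg_le_inv_pow (N : ℕ) {r : ℝ} (hr : 0 ≤ r) :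
    Real.exp (-r) ≤ N.factorial * Real.exp 1 * ((1 + r) ^ N)⁻¹ := by
  -- The argument is `1 + r` rather than `r`, which is what costs the factor `exp 1`.
  have h := Real.pow_div_factorial_le_exp (x := 1 + r) (by linarith) N
  rw [div_le_iff₀ (by positivity), Real.exp_add] at h
  rw [Real.exp_neg, ← div_eq_mul_inv, le_div_iff₀ (by positivity),
    inv_mul_le_iff₀ (Real.exp_pos _)]
  linarith

/-! ### Heat kernel: absolute convergence, semigroup property, localized iterates. -/

namespace DataSpace

variable {X : Type*} [MetricSpace X] [MeasurableSpace X]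

theorem properSpace (Ξ : DataSpace X) : ProperSpace X :=
  .of_isCompact_closedBall_of_le 1 fun x r hr => Ξ.isCompact_closedBall x r (by linarith)

theorem secondCountable (Ξ : DataSpace X) : SecondCountableTopology X :=
  have := Ξ.properSpace
  inferInstance

theorem lam_nonneg (Ξ : DataSpace X) (k : ℕ) : 0 ≤ Ξ.lam k :=
  Ξ.lam_zero ▸ Ξ.lam_mono (Nat.zero_le k)

theorem abs_φ_le (Ξ : DataSpace X) (k : ℕ) (x : X) : |Ξ.φ k x| ≤ ‖Ξ.φ k‖ := by
  rw [← ZeroAtInftyContinuousMap.norm_toBCF_eq_norm]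
  exact (Ξ.φ k).toBCF.norm_coe_le_norm x

theorem continuous_φ (Ξ : DataSpace X) (k : ℕ) : Continuous fun x => Ξ.φ k x :=
  (Ξ.φ k).continuous

theorem measurable_φ [BorelSpace X] (Ξ : DataSpace X) (k : ℕ) : Measurable fun x => Ξ.φ k x :=
  (Ξ.continuous_φ k).measurable

theorem abs_exp_mul_φ_mul_φ (Ξ : DataSpace X) (t : ℝ) (k : ℕ) (x y : X) :
    |Real.exp (-(Ξ.lam k) ^ 2 * t) * Ξ.φ k x * Ξ.φ k y| =
      Real.exp (-(Ξ.lam k) ^ 2 * t) * |Ξ.φ k x| * |Ξ.φ k y| := by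
  rw [abs_mul, abs_mul, abs_of_pos (Real.exp_pos _)]

theorem exp_lam_antitone (Ξ : DataSpace X) (k : ℕ) {s t : ℝ} (h : s ≤ t) :
    Real.exp (-(Ξ.lam k) ^ 2 * t) ≤ Real.exp (-(Ξ.lam k) ^ 2 * s) := by
  apply Real.exp_le_exp.2
  nlinarith [sq_nonneg (Ξ.lam k)]

/-- The constants of the ball measure condition and of the Gaussian upper bound. -/
structure HeatBound (Ξ : DataSpace X) (q κ κ₁ κ₂ : ℝ) : Prop where
  one_le_q : 1 ≤ q
  κ_pos : 0 < κ
  κ₁_pos : 0 < κ₁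
  κ₂_pos : 0 < κ₂
  measure_closedBall_le : ∀ (x : X) (r : ℝ), 0 < r →
    Ξ.μ (closedBall x r) ≤ ENNReal.ofReal (κ * r ^ q)
  gaussian : ∀ (x y : X) (t : ℝ), 0 < t → t ≤ 1 →
    Summable (fun k => Real.exp (-(Ξ.lam k) ^ 2 * t) * Ξ.φ k x * Ξ.φ k y) ∧
      |∑' k, Real.exp (-(Ξ.lam k) ^ 2 * t) * Ξ.φ k x * Ξ.φ k y|
        ≤ κ₁ * t ^ (-q / 2) * Real.exp (-κ₂ * (dist x y ^ 2 / t))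

theorem exists_heatBound (Ξ : DataSpace X) : ∃ q κ κ₁ κ₂, Ξ.HeatBound q κ κ₁ κ₂ := by
  obtain ⟨q, hq, ⟨κ, hκ, hb⟩, κ₁, κ₂, h₁, h₂, hg⟩ := Ξ.ball_and_gaussian
  exact ⟨q, κ, κ₁, κ₂, hq, hκ, h₁, h₂, fun x r hr => (hb x r hr).2, hg⟩

/-- The heat kernel. -/
def heat (Ξ : DataSpace X) (t : ℝ) (x y : X) : ℝ :=
  ∑' k, Real.exp (-(Ξ.lam k) ^ 2 * t) * Ξ.φ k x * Ξ.φ k y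

/-- The majorant of the heat kernel obtained by taking absolute values. -/
def heatAbs (Ξ : DataSpace X) (t : ℝ) (x y : X) : ℝ :=
  ∑' k, Real.exp (-(Ξ.lam k) ^ 2 * t) * |Ξ.φ k x| * |Ξ.φ k y|

namespace HeatBound

variable {Ξ : DataSpace X} {q κ κ₁ κ₂ : ℝ}

theorem summable_abs (H : Ξ.HeatBound q κ κ₁ κ₂) {t : ℝ} (ht : 0 < t) (x y : X) :
    Summable fun k => Real.exp (-(Ξ.lam k) ^ 2 * t) * |Ξ.φ k x| * |Ξ.φ k y| := by
  have h := (H.gaussian x y (min t 1) (by positivity) (min_le_right _ _)).1.abs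
  simp_rw [abs_exp_mul_φ_mul_φ] at h
  refine Summable.of_nonneg_of_le (fun k => by positivity) (fun k => ?_) h
  gcongr ?_ * _ * _
  exact Ξ.exp_lam_antitone k (min_le_left _ _)

theorem summable (H : Ξ.HeatBound q κ κ₁ κ₂) {t : ℝ} (ht : 0 < t) (x y : X) :
    Summable fun k => Real.exp (-(Ξ.lam k) ^ 2 * t) * Ξ.φ k x * Ξ.φ k y := by
  apply Summable.of_abs
  simp_rw [abs_exp_mul_φ_mul_φ]
  exact H.summable_abs ht x y

/-- The inequality `2|ab| ≤ a² + b²` applied termwise reduces the absolute series to the two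
diagonal values, where the series has no cancellation and the Gaussian bound applies with distance
zero. -/
theorem heatAbs_le (H : Ξ.HeatBound q κ κ₁ κ₂) {t : ℝ} (ht : 0 < t) (ht1 : t ≤ 1) (x y : X) :
    Ξ.heatAbs t x y ≤ κ₁ * t ^ (-q / 2) := by
  have diag : ∀ z, ∑' k, Real.exp (-(Ξ.lam k) ^ 2 * t) * Ξ.φ k z * Ξ.φ k z
      ≤ κ₁ * t ^ (-q / 2) := by
    intro z
    simpa using (le_abs_self _).trans (H.gaussian z z t ht ht1).2
  have hx := H.summable ht x x
  have hy := H.summable ht y y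
  calc Ξ.heatAbs t x y
      ≤ ∑' k, (Real.exp (-(Ξ.lam k) ^ 2 * t) * Ξ.φ k x * Ξ.φ k x * (1 / 2) +
          Real.exp (-(Ξ.lam k) ^ 2 * t) * Ξ.φ k y * Ξ.φ k y * (1 / 2)) := by
        refine (H.summable_abs ht x y).tsum_le_tsum (fun k => ?_)
          ((hx.mul_right _).add (hy.mul_right _))
        have h1 : |Ξ.φ k x| * |Ξ.φ k y| ≤ (Ξ.φ k x * Ξ.φ k x + Ξ.φ k y * Ξ.φ k y) * (1 / 2) := by
          nlinarith [sq_nonneg (|Ξ.φ k x| - |Ξ.φ k y|), sq_abs (Ξ.φ k x), sq_abs (Ξ.φ k y)]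
        calc _ = Real.exp (-(Ξ.lam k) ^ 2 * t) * (|Ξ.φ k x| * |Ξ.φ k y|) := by ring
          _ ≤ Real.exp (-(Ξ.lam k) ^ 2 * t) *
              ((Ξ.φ k x * Ξ.φ k x + Ξ.φ k y * Ξ.φ k y) * (1 / 2)) := by gcongr
          _ = _ := by ring
    _ ≤ κ₁ * t ^ (-q / 2) := by
        rw [(hx.mul_right _).tsum_add (hy.mul_right _), tsum_mul_right, tsum_mul_right]
        linarith [diag x, diag y]

/-- The terms decrease in `t`. Times beyond `1`, where no Gaussian bound is assumed, do occur among
the iterates of the heat kernel. -/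
theorem heatAbs_le_min (H : Ξ.HeatBound q κ κ₁ κ₂) {t : ℝ} (ht : 0 < t) (x y : X) :
    Ξ.heatAbs t x y ≤ κ₁ * (min t 1) ^ (-q / 2) := by
  have h0 : 0 < min t 1 := by positivity
  refine le_trans ?_ (H.heatAbs_le h0 (min_le_right _ _) x y)
  refine (H.summable_abs ht x y).tsum_le_tsum (fun k => ?_) (H.summable_abs h0 x y)
  gcongr ?_ * _ * _
  exact Ξ.exp_lam_antitone k (min_le_left _ _)

theorem measurable_heat [BorelSpace X] (H : Ξ.HeatBound q κ κ₁ κ₂) {t : ℝ} (ht : 0 < t) (x : X) :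
    Measurable fun y => Ξ.heat t x y :=
  measurable_tsum_of_summable (fun k => (Ξ.measurable_φ k).const_mul _) fun y => H.summable ht x y

/-- Integration of an integrable function against the heat kernel. -/
theorem hasSum_integral_heat_mul [BorelSpace X] (H : Ξ.HeatBound q κ κ₁ κ₂) {t : ℝ} (ht : 0 < t)
    (x : X) {g : X → ℝ} (hg : Integrable g Ξ.μ) :
    HasSum (fun k => Real.exp (-(Ξ.lam k) ^ 2 * t) * Ξ.φ k x * ∫ u, Ξ.φ k u * g u ∂Ξ.μ)
      (∫ u, Ξ.heat t x u * g u ∂Ξ.μ) := by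
  simp_rw [← integral_const_mul]
  have hbd : ∀ u, ∑' k, Real.exp (-(Ξ.lam k) ^ 2 * t) * |Ξ.φ k x| * |Ξ.φ k u| * |g u| =
      Ξ.heatAbs t x u * |g u| := fun u => tsum_mul_right
  refine hasSum_integral_of_dominated_convergence
    (fun k u => Real.exp (-(Ξ.lam k) ^ 2 * t) * |Ξ.φ k x| * |Ξ.φ k u| * |g u|)
    (fun k => (((Ξ.measurable_φ k).aestronglyMeasurable).mul hg.1).const_mul _)
    (fun k => Eventually.of_forall fun u => ?_)
    (Eventually.of_forall fun u => (H.summable_abs ht x u).mul_right _) ?_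
    (Eventually.of_forall fun u => ?_)
  · rw [← mul_assoc, norm_mul, Real.norm_eq_abs, abs_exp_mul_φ_mul_φ, Real.norm_eq_abs]
  · simp_rw [hbd]
    refine hg.abs.bdd_mul (c := κ₁ * (min t 1) ^ (-q / 2)) ?_ (Eventually.of_forall fun u => ?_)
    · exact (measurable_tsum_of_summable
        (fun k => (Ξ.measurable_φ k).abs.const_mul _)
        fun u => H.summable_abs ht x u).aestronglyMeasurable
    · rw [Real.norm_eq_abs, abs_of_nonneg (tsum_nonneg fun k => by positivity)]
      exact H.heatAbs_le_min ht x u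
  · simp_rw [← mul_assoc]
    exact (H.summable ht x u).hasSum.mul_right _

/-- By orthonormality a single term of the series survives; this eigenfunction relation is what
yields the semigroup property. -/
theorem integral_heat_mul_φ [BorelSpace X] (H : Ξ.HeatBound q κ κ₁ κ₂) {t : ℝ} (ht : 0 < t)
    (x : X) (k : ℕ) :
    ∫ u, Ξ.heat t x u * Ξ.φ k u ∂Ξ.μ = Real.exp (-(Ξ.lam k) ^ 2 * t) * Ξ.φ k x := by
  refine (H.hasSum_integral_heat_mul ht x (Ξ.φ_integrable k)).unique ?_
  simp_rw [Ξ.φ_orthonormal]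
  convert hasSum_ite_eq k (Real.exp (-(Ξ.lam k) ^ 2 * t) * Ξ.φ k x) using 2 with j
  split_ifs with hj
  · rw [hj, mul_one]
  · rw [mul_zero]

/-- The semigroup property of the heat kernel. -/
theorem heat_add [BorelSpace X] (H : Ξ.HeatBound q κ κ₁ κ₂) {s t : ℝ} (hs : 0 < s) (ht : 0 < t)
    (x y : X) (hi : Integrable (fun u => Ξ.heat t y u) Ξ.μ) :
    Ξ.heat (s + t) x y = ∫ u, Ξ.heat s x u * Ξ.heat t y u ∂Ξ.μ := by
  have h := (H.hasSum_integral_heat_mul hs x hi).tsum_eq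
  rw [← h]
  refine tsum_congr fun k => ?_
  simp_rw [mul_comm (Ξ.φ k _) (Ξ.heat t y _)]
  rw [H.integral_heat_mul_φ ht y k, mul_add, Real.exp_add]
  ring

/-- Integrability of the localization profile, uniformly in the center and the scale. -/
theorem lintegral_inv_pow_le [BorelSpace X] (H : Ξ.HeatBound q κ κ₁ κ₂) :
    ∃ C : ℝ, 0 < C ∧ ∀ (n : ℝ), 0 < n → ∀ x,
      ∫⁻ y, ENNReal.ofReal (((1 + n * dist x y) ^ (⌈q⌉₊ + 2))⁻¹) ∂Ξ.μ
        ≤ ENNReal.ofReal (C * n ^ (-q)) := by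
  have hs : Summable fun m : ℕ => (((m : ℝ) + 1) ^ 2)⁻¹ := by
    have := (summable_nat_add_iff 1).2 (Real.summable_nat_pow_inv (p := 2) |>.2 (by norm_num))
    simpa using this
  refine ⟨κ * ∑' m : ℕ, (((m : ℝ) + 1) ^ 2)⁻¹, mul_pos H.κ_pos
    (hs.tsum_pos (fun m => by positivity) 0 (by positivity)), fun n hn x => ?_⟩
  -- Cut the space into shells by the integer part of `n ρ(x, y)`. Of the `⌈q⌉₊ + 2` powers, the
  -- first `⌈q⌉₊` absorb the growth of the ball measure and the remaining two leave a convergent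
  -- series.
  set N := ⌈q⌉₊ + 2
  calc ∫⁻ y, ENNReal.ofReal (((1 + n * dist x y) ^ N)⁻¹) ∂Ξ.μ
      ≤ ∫⁻ y, ∑' m : ℕ, (closedBall x (((m : ℝ) + 1) / n)).indicator
          (fun _ => ENNReal.ofReal ((((m : ℝ) + 1) ^ N)⁻¹)) y ∂Ξ.μ := by
        refine lintegral_mono fun y => ?_
        have h0 : 0 ≤ n * dist x y := by positivity
        refine le_trans ?_ (ENNReal.le_tsum ⌊n * dist x y⌋₊)
        rw [Set.indicator_of_mem]
        · apply ENNReal.ofReal_le_ofReal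
          rw [add_comm (1 : ℝ)]
          gcongr
          exact Nat.floor_le h0
        · rw [mem_closedBall, dist_comm, le_div_iff₀ hn, mul_comm]
          exact (Nat.lt_floor_add_one _).le
    _ = ∑' m : ℕ, ENNReal.ofReal ((((m : ℝ) + 1) ^ N)⁻¹) *
          Ξ.μ (closedBall x (((m : ℝ) + 1) / n)) := by
        rw [lintegral_tsum fun m =>
          (measurable_const.indicator isClosed_closedBall.measurableSet).aemeasurable]
        refine tsum_congr fun m => ?_
        rw [lintegral_indicator_const isClosed_closedBall.measurableSet]
    _ ≤ ∑' m : ℕ, ENNReal.ofReal (κ * n ^ (-q) * (((m : ℝ) + 1) ^ 2)⁻¹) := by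
        refine ENNReal.tsum_le_tsum fun m => ?_
        have hm : (0 : ℝ) < (m : ℝ) + 1 := by positivity
        calc _ ≤ ENNReal.ofReal ((((m : ℝ) + 1) ^ N)⁻¹) *
              ENNReal.ofReal (κ * (((m : ℝ) + 1) / n) ^ q) := by
              gcongr
              exact H.measure_closedBall_le x _ (by positivity)
          _ = ENNReal.ofReal ((((m : ℝ) + 1) ^ N)⁻¹ * (κ * (((m : ℝ) + 1) / n) ^ q)) :=
              (ENNReal.ofReal_mul (by positivity)).symm
          _ ≤ _ := by
              apply ENNReal.ofReal_le_ofReal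
              rw [Real.div_rpow hm.le hn.le, Real.rpow_neg hn.le, pow_add]
              have h1 : ((m : ℝ) + 1) ^ q ≤ ((m : ℝ) + 1) ^ ⌈q⌉₊ := by
                rw [← Real.rpow_natCast]
                exact Real.rpow_le_rpow_of_exponent_le (by linarith [m.cast_nonneg (α := ℝ)])
                  (Nat.le_ceil q)
              calc _ = κ * (n ^ q)⁻¹ * (((m : ℝ) + 1) ^ 2)⁻¹ *
                    (((m : ℝ) + 1) ^ q / ((m : ℝ) + 1) ^ ⌈q⌉₊) := by
                    field_simp
                _ ≤ κ * (n ^ q)⁻¹ * (((m : ℝ) + 1) ^ 2)⁻¹ * 1 := by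
                    have := H.κ_pos
                    gcongr
                    exact (div_le_one (by positivity)).2 h1
                _ = _ := mul_one _
    _ = ENNReal.ofReal (κ * (∑' m : ℕ, (((m : ℝ) + 1) ^ 2)⁻¹) * n ^ (-q)) := by
        have := H.κ_pos
        rw [← ENNReal.ofReal_tsum_of_nonneg (fun m => by positivity) (hs.mul_left _),
          tsum_mul_left]
        congr 1; ring

theorem lintegral_exp_le [BorelSpace X] (H : Ξ.HeatBound q κ κ₁ κ₂) :
    ∃ C : ℝ, 0 < C ∧ ∀ (n : ℝ), 0 < n → ∀ x,
      ∫⁻ y, ENNReal.ofReal (Real.exp (-(n * dist x y))) ∂Ξ.μ ≤ ENNReal.ofReal (C * n ^ (-q)) := by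
  obtain ⟨C, hC, h⟩ := H.lintegral_inv_pow_le
  set N := ⌈q⌉₊ + 2
  refine ⟨N.factorial * Real.exp 1 * C, by positivity, fun n hn x => ?_⟩
  calc _ ≤ ∫⁻ y, ENNReal.ofReal (N.factorial * Real.exp 1) *
        ENNReal.ofReal (((1 + n * dist x y) ^ N)⁻¹) ∂Ξ.μ := by
        refine lintegral_mono fun y => ?_
        rw [← ENNReal.ofReal_mul (by positivity)]
        exact ENNReal.ofReal_le_ofReal (exp_neg_le_inv_pow N (by positivity))
    _ = ENNReal.ofReal (N.factorial * Real.exp 1) *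
        ∫⁻ y, ENNReal.ofReal (((1 + n * dist x y) ^ N)⁻¹) ∂Ξ.μ :=
        lintegral_const_mul' _ _ ENNReal.ofReal_ne_top
    _ ≤ ENNReal.ofReal (N.factorial * Real.exp 1) * ENNReal.ofReal (C * n ^ (-q)) := by
        gcongr; exact h n hn x
    _ = _ := by rw [← ENNReal.ofReal_mul (by positivity)]; congr 1; ring

theorem rpow_inv_sq {n : ℝ} (hn : 0 < n) (q : ℝ) : ((n ^ 2)⁻¹ : ℝ) ^ (-q / 2) = n ^ q := by
  rw [← Real.rpow_natCast, ← Real.rpow_neg hn.le, ← Real.rpow_mul hn.le]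
  congr 1; push_cast; ring

theorem inv_sq_le_one {n : ℝ} (hn : 1 ≤ n) : ((n ^ 2)⁻¹ : ℝ) ≤ 1 :=
  inv_le_one_of_one_le₀ (one_le_pow₀ hn)

/-- Completing the square in `κ₂ s² - 2s + κ₂⁻¹ ≥ 0`, `s = n ρ(x, y)`, trades the Gaussian for an
exponential. The rate `2` is twice what is propagated: the surplus pays for the convolution integral
in `abs_heat_iterate_le`. -/
theorem abs_heat_inv_sq_le (H : Ξ.HeatBound q κ κ₁ κ₂) {n : ℝ} (hn : 1 ≤ n) (x y : X) :
    |Ξ.heat (n ^ 2)⁻¹ x y|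
      ≤ κ₁ * Real.exp (κ₂⁻¹) * n ^ q * Real.exp (-(2 * (n * dist x y))) := by
  have hn0 : 0 < n := by linarith
  refine (H.gaussian x y _ (by positivity) (inv_sq_le_one hn)).2.trans ?_
  rw [rpow_inv_sq hn0]
  have h1 := H.κ₁_pos
  have h2 := H.κ₂_pos
  have : Real.exp (-κ₂ * (dist x y ^ 2 / (n ^ 2)⁻¹))
      ≤ Real.exp (κ₂⁻¹) * Real.exp (-(2 * (n * dist x y))) := by
    rw [← Real.exp_add]
    apply Real.exp_le_exp.2
    have h3 : κ₂⁻¹ * (κ₂ * (n * dist x y) - 1) ^ 2 =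
        κ₂ * (n * dist x y) ^ 2 - 2 * (n * dist x y) + κ₂⁻¹ := by
      field_simp
      ring
    have h4 : 0 ≤ κ₂⁻¹ * (κ₂ * (n * dist x y) - 1) ^ 2 := by positivity
    rw [div_inv_eq_mul]
    nlinarith
  calc _ ≤ κ₁ * n ^ q * (Real.exp (κ₂⁻¹) * Real.exp (-(2 * (n * dist x y)))) := by gcongr
    _ = _ := by ring

/-- Exponential localization of the iterates of the heat kernel at time `n⁻²`. -/
theorem abs_heat_iterate_le [BorelSpace X] (H : Ξ.HeatBound q κ κ₁ κ₂) :
    ∃ C : ℝ, 0 < C ∧ ∀ n : ℝ, 1 ≤ n → ∀ (k : ℕ) (x y : X),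
      |Ξ.heat ((k + 1) * (n ^ 2)⁻¹) x y| ≤ C ^ (k + 1) * n ^ q * Real.exp (-(n * dist x y)) := by
  obtain ⟨C₁, hC₁, hI⟩ := H.lintegral_exp_le
  have h1 := H.κ₁_pos
  set C₀ := κ₁ * Real.exp (κ₂⁻¹) with hC₀
  have hC₀p : 0 < C₀ := by positivity
  -- `C₀` is needed for the first iterate, and `C₀ * C₁` is the factor gained with each convolution.
  refine ⟨max C₀ (C₀ * C₁), by positivity, fun n hn k => ?_⟩
  set C := max C₀ (C₀ * C₁)
  have hn0 : 0 < n := by linarith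
  have hs : 0 < (n ^ 2)⁻¹ := by positivity
  have hexp : ∀ y u : X, n * dist y u ≤ 2 * (n * dist y u) := fun y u => by
    linarith [mul_nonneg hn0.le (dist_nonneg (x := y) (y := u))]
  have hint : ∀ y, Integrable (fun u => Ξ.heat (n ^ 2)⁻¹ y u) Ξ.μ := by
    intro y
    refine ⟨(H.measurable_heat hs y).aestronglyMeasurable, ?_⟩
    rw [hasFiniteIntegral_iff_enorm]
    calc _ ≤ ∫⁻ u, ENNReal.ofReal (C₀ * n ^ q) *
          ENNReal.ofReal (Real.exp (-(n * dist y u))) ∂Ξ.μ := by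
          refine lintegral_mono fun u => ?_
          rw [Real.enorm_eq_ofReal_abs, ← ENNReal.ofReal_mul (by positivity)]
          exact ENNReal.ofReal_le_ofReal ((H.abs_heat_inv_sq_le hn y u).trans
            (mul_le_mul_of_nonneg_left (Real.exp_le_exp.2 (neg_le_neg (hexp y u))) (by positivity)))
      _ = ENNReal.ofReal (C₀ * n ^ q) * ∫⁻ u, ENNReal.ofReal (Real.exp (-(n * dist y u))) ∂Ξ.μ :=
          lintegral_const_mul' _ _ ENNReal.ofReal_ne_top
      _ < ⊤ := ENNReal.mul_lt_top ENNReal.ofReal_lt_top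
          ((hI n hn0 y).trans_lt ENNReal.ofReal_lt_top)
  induction k with
  | zero =>
    intro x y
    simp only [Nat.cast_zero, zero_add, one_mul, pow_one]
    refine (H.abs_heat_inv_sq_le hn x y).trans ?_
    gcongr ?_ * _ * ?_
    · exact le_max_left _ _
    · exact Real.exp_le_exp.2 (neg_le_neg (hexp x y))
  | succ k ih =>
    intro x y
    have e : (((k + 1 : ℕ) : ℝ) + 1) * (n ^ 2)⁻¹ = ((k : ℝ) + 1) * (n ^ 2)⁻¹ + (n ^ 2)⁻¹ := by
      push_cast; ring
    rw [e, H.heat_add (by positivity) hs x y (hint y)]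
    set A := C ^ (k + 1) * n ^ q * (C₀ * n ^ q) * Real.exp (-(n * dist x y)) with hA
    have hA0 : 0 ≤ A := by positivity
    have key : ‖∫ u, Ξ.heat (((k : ℝ) + 1) * (n ^ 2)⁻¹) x u * Ξ.heat (n ^ 2)⁻¹ y u ∂Ξ.μ‖ₑ
        ≤ ENNReal.ofReal (A * (C₁ * n ^ (-q))) := by
      calc _ ≤ ∫⁻ u, ‖Ξ.heat (((k : ℝ) + 1) * (n ^ 2)⁻¹) x u * Ξ.heat (n ^ 2)⁻¹ y u‖ₑ ∂Ξ.μ :=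
            enorm_integral_le_lintegral_enorm _
        _ ≤ ∫⁻ u, ENNReal.ofReal A * ENNReal.ofReal (Real.exp (-(n * dist y u))) ∂Ξ.μ := by
            refine lintegral_mono fun u => ?_
            rw [Real.enorm_eq_ofReal_abs, ← ENNReal.ofReal_mul hA0, abs_mul]
            apply ENNReal.ofReal_le_ofReal
            -- Of the two copies of `exp(-n ρ(y, u))`, one combines with `exp(-n ρ(x, u))` through
            -- the triangle inequality, and the other is left to be integrated in `u`.
            have hE : Real.exp (-(n * dist x u)) * Real.exp (-(2 * (n * dist y u)))
                ≤ Real.exp (-(n * dist x y)) * Real.exp (-(n * dist y u)) := by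
              rw [← Real.exp_add, ← Real.exp_add]
              apply Real.exp_le_exp.2
              have := dist_triangle_right x y u
              nlinarith
            calc _ ≤ (C ^ (k + 1) * n ^ q * Real.exp (-(n * dist x u))) *
                  (C₀ * n ^ q * Real.exp (-(2 * (n * dist y u)))) :=
                  mul_le_mul (ih x u) (H.abs_heat_inv_sq_le hn y u) (abs_nonneg _)
                    (by positivity)
              _ = C ^ (k + 1) * n ^ q * (C₀ * n ^ q) *
                  (Real.exp (-(n * dist x u)) * Real.exp (-(2 * (n * dist y u)))) := by ring
              _ ≤ C ^ (k + 1) * n ^ q * (C₀ * n ^ q) *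
                  (Real.exp (-(n * dist x y)) * Real.exp (-(n * dist y u))) := by gcongr
              _ = _ := by ring
        _ = ENNReal.ofReal A * ∫⁻ u, ENNReal.ofReal (Real.exp (-(n * dist y u))) ∂Ξ.μ :=
            lintegral_const_mul' _ _ ENNReal.ofReal_ne_top
        _ ≤ ENNReal.ofReal A * ENNReal.ofReal (C₁ * n ^ (-q)) := by
            gcongr; exact hI n hn0 y
        _ = _ := (ENNReal.ofReal_mul hA0).symm
    rw [Real.enorm_eq_ofReal_abs, ENNReal.ofReal_le_ofReal_iff (by positivity)] at key
    refine key.trans ?_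
    have hnq : n ^ q * n ^ (-q) = 1 := by
      rw [← Real.rpow_add hn0]; simp
    calc A * (C₁ * n ^ (-q)) = C ^ (k + 1) * (C₀ * C₁) * n ^ q * Real.exp (-(n * dist x y)) *
          (n ^ q * n ^ (-q)) := by rw [hA]; ring
      _ ≤ C ^ (k + 1) * C * n ^ q * Real.exp (-(n * dist x y)) * 1 := by
          rw [hnq]
          gcongr
          exact le_max_right _ _
      _ = _ := by rw [pow_succ C (k + 1)]; ring

end HeatBound

end DataSpace

/-! ### Fourier representation of the filter. -/

/-- The profile of `h` in the variable `v = exp (-t ^ 2)`, divided by `v`, is smooth. -/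
theorem contDiff_lowPass_sqrt_neg_log {h : ℝ → ℝ} (hh : IsLowPass h) :
    ContDiff ℝ ((⊤ : ℕ∞) : WithTop ℕ∞) fun v : ℝ => h (√(-Real.log v)) / v := by
  rw [contDiff_iff_contDiffAt]
  intro v
  rcases eq_or_ne v 0 with rfl | hv
  -- For small `w ≠ 0` of either sign, `Real.log w = log |w| < -1`, so `h` is evaluated beyond `1`
  -- and vanishes. At `w = 0` the convention for division by zero gives the same value.
  · refine (contDiffAt_const (c := (0 : ℝ))).congr_of_eventuallyEq ?_
    filter_upwards [Metric.ball_mem_nhds (0 : ℝ) (Real.exp_pos (-1))] with w hw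
    rcases eq_or_ne w 0 with rfl | hw0
    · simp
    have hw1 : |w| < Real.exp (-1) := by simpa using hw
    have hl : Real.log w < -1 := by
      rw [← Real.log_abs, Real.log_lt_iff_lt_exp (abs_pos.2 hw0)]
      exact hw1
    rw [hh.eq_zero _ (by rw [Real.le_sqrt' one_pos]; linarith), zero_div]
  · rcases lt_or_ge (Real.log v) 0 with hl | hl
    · have h1 : ContDiffAt ℝ ((⊤ : ℕ∞) : WithTop ℕ∞) (fun v : ℝ => √(-Real.log v)) v :=
        ((Real.contDiffAt_log.2 hv).neg).sqrt (neg_pos.2 hl).ne'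
      exact (hh.contDiff.contDiffAt.comp v h1).div contDiffAt_id hv
    -- The square root is not smooth where `log v = 0`, but there its values stay in the region
    -- where `h` is `1`, so the function is `1 / w` nearby.
    · refine ((contDiffAt_inv ℝ hv).congr_of_eventuallyEq ?_)
      have := (Real.continuousAt_log hv).eventually (lt_mem_nhds (by linarith : -(1 / 4) < Real.log v))
      filter_upwards [this] with w hw
      rw [hh.eq_one _ ?_, one_div]
      rw [abs_of_nonneg (Real.sqrt_nonneg _), Real.sqrt_le_left (by norm_num)]
      linarith

open FourierTransform in
/-- Fourier representation of a low-pass filter: the profile `h` is a superposition of the functions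
`v exp (2 π i ξ v)`, `v = exp (-t ^ 2)`, with a rapidly decreasing density. -/
theorem exists_fourier_representation {h : ℝ → ℝ} (hh : IsLowPass h) :
    ∃ g : ℝ → ℂ, (∀ T : ℕ, Integrable fun ξ => (1 + |ξ|) ^ T * ‖g ξ‖) ∧ Integrable g ∧
      ∀ t : ℝ, 0 ≤ t → (h t : ℂ) = ∫ ξ, g ξ * (Real.exp (-t ^ 2) *
        Complex.exp ((2 * Real.pi * ξ : ℝ) * Complex.I * Real.exp (-t ^ 2))) := by
  -- The bump is `1` on `[-1, 1]`, which contains every value `exp(-t²)`; it removes the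
  -- non-integrable tail `1 / v` at infinity without changing the values needed.
  let χ : ContDiffBump (0 : ℝ) := ⟨1, 2, one_pos, one_lt_two⟩
  let F : ℝ → ℂ := fun v => ((χ v * (h (√(-Real.log v)) / v) : ℝ) : ℂ)
  have hFs : ContDiff ℝ ((⊤ : ℕ∞) : WithTop ℕ∞) F :=
    Complex.ofRealCLM.contDiff.comp (χ.contDiff.mul (contDiff_lowPass_sqrt_neg_log hh))
  have hFc : HasCompactSupport F :=
    (χ.hasCompactSupport.mul_right (f' := fun v => h (√(-Real.log v)) / v)).comp_left
      Complex.ofReal_zero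
  let S := hFc.toSchwartzMap hFs
  let G : SchwartzMap ℝ ℂ := 𝓕 S
  refine ⟨fun ξ => G ξ, fun T => ?_, G.integrable, fun t ht => ?_⟩
  · refine ((G.integrable_pow_mul volume 0).const_mul (2 ^ (T - 1)) |>.add
      ((G.integrable_pow_mul volume T).const_mul (2 ^ (T - 1)))).mono' ?_ ?_
    · exact (by fun_prop : Continuous fun ξ : ℝ => (1 + |ξ|) ^ T * ‖G ξ‖).aestronglyMeasurable
    · refine Eventually.of_forall fun ξ => ?_
      rw [Real.norm_of_nonneg (by positivity)]
      have := add_pow_le zero_le_one (abs_nonneg ξ) T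
      simp only [pow_zero, one_mul, Real.norm_eq_abs, Pi.add_apply]
      calc _ ≤ 2 ^ (T - 1) * (1 ^ T + |ξ| ^ T) * ‖G ξ‖ := by gcongr
        _ = _ := by rw [one_pow]; ring
  · set v := Real.exp (-t ^ 2) with hv
    have hv0 : 0 < v := Real.exp_pos _
    have hv1 : v ≤ 1 := Real.exp_le_one_iff.2 (by nlinarith)
    have hSv : S v = ((h t / v : ℝ) : ℂ) := by
      change ((χ v * (h (√(-Real.log v)) / v) : ℝ) : ℂ) = _
      rw [χ.one_of_mem_closedBall (by
        rw [mem_closedBall, Real.dist_eq, sub_zero, abs_of_pos hv0]; exact hv1), one_mul, hv,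
        Real.log_exp, neg_neg, Real.sqrt_sq ht]
    have hinv : S v = ∫ ξ : ℝ, Complex.exp (↑(2 * Real.pi * inner ℝ ξ v) * Complex.I) • G ξ := by
      rw [← Real.fourierInv_eq' (⇑G) v, ← SchwartzMap.fourierInv_coe,
        FourierPair.fourierInv_fourier_eq]
    have : (h t : ℂ) = v * S v := by
      rw [hSv, ← Complex.ofReal_mul, mul_div_cancel₀ _ hv0.ne']
    rw [this, hinv, ← integral_const_mul]
    refine integral_congr_ae (Eventually.of_forall fun ξ => ?_)
    have e : (↑(2 * Real.pi * inner ℝ ξ v) : ℂ) * Complex.I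
        = ↑(2 * Real.pi * ξ) * Complex.I * v := by
      simp [inner]; ring
    simp only [smul_eq_mul, e]
    ring

/-- Trading exponential for polynomial localization. -/
theorem pow_mul_le_of_le_exp {A a C Y : ℝ} (hA : 0 ≤ A) (ha : 0 ≤ a) (hC : 0 ≤ C) (T : ℕ)
    {r w : ℝ} (hr : 0 ≤ r) (hw : 0 ≤ w) (hY : 0 ≤ Y) (h₁ : Y ≤ A)
    (h₂ : Y ≤ C * Real.exp (a * w - r)) :
    (1 + r) ^ T * Y ≤ (A * (1 + 2 * a) ^ T + C * (2 ^ T * (T.factorial * Real.exp 1))) *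
      (1 + w) ^ T := by
  have hw1 : 1 ≤ (1 + w) ^ T := one_le_pow₀ (by linarith)
  -- If `r` is at most `2aw`, the powers of `1 + r` are paid for by powers of `1 + w` and the
  -- uniform bound suffices. Otherwise the exponent is at most `-r / 2`, which beats any power.
  rcases le_or_gt r (2 * a * w) with h | h
  · calc (1 + r) ^ T * Y ≤ ((1 + 2 * a) * (1 + w)) ^ T * A := by
          gcongr
          nlinarith [mul_nonneg ha hw]
      _ = A * (1 + 2 * a) ^ T * (1 + w) ^ T := by rw [mul_pow]; ring
      _ ≤ _ := by
          gcongr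
          linarith [show 0 ≤ C * (2 ^ T * (T.factorial * Real.exp 1)) by positivity]
  · have e1 : (1 + r) ^ T ≤ 2 ^ T * (1 + r / 2) ^ T := by
      rw [← mul_pow]; gcongr; linarith
    have e2 := exp_neg_le_inv_pow T (r := r / 2) (by linarith)
    have e3 : Real.exp (a * w - r) ≤ Real.exp (-(r / 2)) := Real.exp_le_exp.2 (by linarith)
    calc (1 + r) ^ T * Y ≤ (2 ^ T * (1 + r / 2) ^ T) * (C * Real.exp (a * w - r)) := by gcongr
      _ ≤ (2 ^ T * (1 + r / 2) ^ T) *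
          (C * (T.factorial * Real.exp 1 * ((1 + r / 2) ^ T)⁻¹)) := by
          gcongr
          exact e3.trans e2
      _ = C * (2 ^ T * (T.factorial * Real.exp 1)) * 1 := by
          field_simp
      _ ≤ (A * (1 + 2 * a) ^ T + C * (2 ^ T * (T.factorial * Real.exp 1))) * (1 + w) ^ T := by
          gcongr
          linarith [show 0 ≤ A * (1 + 2 * a) ^ T by positivity]

/-! ### Localization of the summability kernels. -/

namespace DataSpace

variable {X : Type*} [MetricSpace X] [MeasurableSpace X]

/-- The summability kernel `∑ h(λ_k / n) φ_k(x) φ_k(y)`. -/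
def kernel (Ξ : DataSpace X) (h : ℝ → ℝ) (n : ℝ) (x y : X) : ℝ :=
  ∑' k, h (Ξ.lam k / n) * Ξ.φ k x * Ξ.φ k y

theorem kernel_comm (Ξ : DataSpace X) (h : ℝ → ℝ) (n : ℝ) (x y : X) :
    Ξ.kernel h n x y = Ξ.kernel h n y x :=
  tsum_congr fun k => by ring

/-- The kernel of `v exp (z v)`, `v = exp (-s L)`. -/
def expKernel (Ξ : DataSpace X) (s : ℝ) (z : ℂ) (x y : X) : ℂ :=
  ∑' k, (Real.exp (-(Ξ.lam k) ^ 2 * s) * Ξ.φ k x * Ξ.φ k y : ℝ) *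
    Complex.exp (z * Real.exp (-(Ξ.lam k) ^ 2 * s))

theorem norm_expKernel_term (Ξ : DataSpace X) (s : ℝ) {z : ℂ} (hz : z.re = 0) (x y : X) (k : ℕ) :
    ‖(Real.exp (-(Ξ.lam k) ^ 2 * s) * Ξ.φ k x * Ξ.φ k y : ℝ) *
      Complex.exp (z * Real.exp (-(Ξ.lam k) ^ 2 * s))‖ =
      Real.exp (-(Ξ.lam k) ^ 2 * s) * |Ξ.φ k x| * |Ξ.φ k y| := by
  rw [norm_mul, Complex.norm_real, Real.norm_eq_abs, abs_exp_mul_φ_mul_φ, Complex.norm_exp,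
    Complex.re_mul_ofReal, hz, zero_mul, Real.exp_zero, mul_one]

namespace HeatBound

variable {Ξ : DataSpace X} {q κ κ₁ κ₂ : ℝ}

theorem summable_expKernel (H : Ξ.HeatBound q κ κ₁ κ₂) {s : ℝ} (hs : 0 < s) {z : ℂ}
    (hz : z.re = 0) (x y : X) :
    Summable fun k => (Real.exp (-(Ξ.lam k) ^ 2 * s) * Ξ.φ k x * Ξ.φ k y : ℝ) *
      Complex.exp (z * Real.exp (-(Ξ.lam k) ^ 2 * s)) := by
  apply Summable.of_norm
  simp_rw [Ξ.norm_expKernel_term s hz]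
  exact H.summable_abs hs x y

/-- For imaginary `z` the exponential factors have modulus one, so the absolute heat series
dominates independently of `z`. -/
theorem norm_expKernel_le (H : Ξ.HeatBound q κ κ₁ κ₂) {s : ℝ} (hs : 0 < s) (hs1 : s ≤ 1) {z : ℂ}
    (hz : z.re = 0) (x y : X) : ‖Ξ.expKernel s z x y‖ ≤ κ₁ * s ^ (-q / 2) := by
  refine (norm_tsum_le_tsum_norm ?_).trans ?_
  · exact (H.summable_expKernel hs hz x y).norm
  · simp_rw [Ξ.norm_expKernel_term s hz]
    exact H.heatAbs_le hs hs1 x y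

/-- Taylor expansion of the exponential kernel in terms of the iterates of the heat kernel. -/
theorem expKernel_eq_tsum (H : Ξ.HeatBound q κ κ₁ κ₂) {s : ℝ} (hs : 0 < s) (z : ℂ) (x y : X) :
    Ξ.expKernel s z x y = ∑' j : ℕ, z ^ j / j.factorial * (Ξ.heat ((j + 1) * s) x y : ℂ) := by
  set a : ℕ → ℕ → ℂ := fun k j => z ^ j / j.factorial *
    ((Real.exp (-(Ξ.lam k) ^ 2 * ((j + 1) * s)) * Ξ.φ k x * Ξ.φ k y : ℝ) : ℂ) with ha
  have hpow : ∀ k (j : ℕ), Real.exp (-(Ξ.lam k) ^ 2 * ((j + 1) * s)) =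
      Real.exp (-(Ξ.lam k) ^ 2 * s) * Real.exp (-(Ξ.lam k) ^ 2 * s) ^ j := by
    intro k j
    rw [← Real.exp_nat_mul, ← Real.exp_add]
    congr 1; ring
  -- The double series is dominated by the product of the absolute heat series and the series of
  -- `exp ‖z‖`, which permits interchanging the sums.
  have hsum : Summable (Function.uncurry a) := by
    have h2 := NormedSpace.expSeries_div_summable (𝔸 := ℝ) ‖z‖
    refine Summable.of_norm_bounded ((H.summable_abs hs x y).mul_of_nonneg h2
      (fun k => by positivity) (fun j => by positivity)) ?_
    rintro ⟨k, j⟩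
    simp only [Function.uncurry, ha]
    rw [norm_mul, Complex.norm_real, Real.norm_eq_abs, abs_exp_mul_φ_mul_φ, norm_div, norm_pow,
      Complex.norm_natCast, mul_comm]
    gcongr ?_ * _ * _ * _
    exact Ξ.exp_lam_antitone k (le_mul_of_one_le_left hs.le (by linarith [j.cast_nonneg (α := ℝ)]))
  have e1 : ∀ k, (Real.exp (-(Ξ.lam k) ^ 2 * s) * Ξ.φ k x * Ξ.φ k y : ℝ) *
      Complex.exp (z * Real.exp (-(Ξ.lam k) ^ 2 * s)) = ∑' j, a k j := by
    intro k
    have := NormedSpace.expSeries_div_hasSum_exp (z * Real.exp (-(Ξ.lam k) ^ 2 * s))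
    rw [← Complex.exp_eq_exp_ℂ] at this
    rw [← (this.mul_left
      ((Real.exp (-(Ξ.lam k) ^ 2 * s) * Ξ.φ k x * Ξ.φ k y : ℝ) : ℂ)).tsum_eq]
    refine tsum_congr fun j => ?_
    simp only [ha]
    rw [hpow, mul_pow]
    push_cast
    ring
  have e2 : ∀ j : ℕ, z ^ j / j.factorial * (Ξ.heat ((j + 1) * s) x y : ℂ) = ∑' k, a k j := by
    intro j
    simp only [ha]
    rw [tsum_mul_left, ← Complex.ofReal_tsum]
    rfl
  simp_rw [e2]
  rw [hsum.tsum_comm]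
  exact tsum_congr e1

/-- The factors `C^(j + 1)` of the iterates sum against the Taylor coefficients of `exp(zv)`. The
growth in `‖z‖` is exponential but the decay in the distance is genuine, in contrast with
`norm_expKernel_le`. -/
theorem norm_expKernel_le_exp [BorelSpace X] (H : Ξ.HeatBound q κ κ₁ κ₂) :
    ∃ C : ℝ, 0 < C ∧ ∀ n : ℝ, 1 ≤ n → ∀ (z : ℂ) (x y : X),
      ‖Ξ.expKernel (n ^ 2)⁻¹ z x y‖ ≤ C * n ^ q * Real.exp (C * ‖z‖ - n * dist x y) := by
  obtain ⟨C, hC, h⟩ := H.abs_heat_iterate_le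
  refine ⟨C, hC, fun n hn z x y => ?_⟩
  have hn0 : 0 < n := by linarith
  rw [H.expKernel_eq_tsum (by positivity)]
  have h2 := (NormedSpace.expSeries_div_hasSum_exp (C * ‖z‖)).mul_left
    (C * n ^ q * Real.exp (-(n * dist x y)))
  rw [← Real.exp_eq_exp_ℝ] at h2
  have := tsum_of_norm_bounded h2 (f := fun j : ℕ => z ^ j / j.factorial *
    (Ξ.heat ((j + 1) * (n ^ 2)⁻¹) x y : ℂ)) fun j => by
      rw [norm_mul, Complex.norm_real, Real.norm_eq_abs, norm_div, norm_pow, Complex.norm_natCast]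
      calc _ ≤ ‖z‖ ^ j / j.factorial * (C ^ (j + 1) * n ^ q * Real.exp (-(n * dist x y))) := by
            gcongr
            exact h n hn j x y
        _ = _ := by rw [mul_pow]; ring
  refine this.trans_eq ?_
  rw [sub_eq_add_neg, Real.exp_add]; ring

/-- Localization of the summability kernels. -/
theorem exists_kernel_localized [BorelSpace X] (H : Ξ.HeatBound q κ κ₁ κ₂) {h : ℝ → ℝ}
    (hh : IsLowPass h) (T : ℕ) :
    ∃ C : ℝ, 0 < C ∧ ∀ n : ℝ, 1 ≤ n → ∀ x y : X,
      (1 + n * dist x y) ^ T * |Ξ.kernel h n x y| ≤ C * n ^ q := by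
  obtain ⟨g, hgT, hg, hrep⟩ := exists_fourier_representation hh
  obtain ⟨C, hC, hexp⟩ := H.norm_expKernel_le_exp
  have h1 := H.κ₁_pos
  -- The parameter at frequency `ξ` has modulus `2π|ξ|`, so `C‖z‖` becomes `a|ξ|`.
  set a := C * (2 * Real.pi) with ha
  have ha0 : 0 < a := by positivity
  set D := κ₁ * (1 + 2 * a) ^ T + C * (2 ^ T * (T.factorial * Real.exp 1)) with hD
  have hD0 : 0 < D := by positivity
  set J := ∫ ξ, (1 + |ξ|) ^ T * ‖g ξ‖
  have hJ : 0 ≤ J := integral_nonneg fun ξ => by positivity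
  -- The added `1` only makes the constant positive without proving `J > 0`.
  refine ⟨D * J + 1, by positivity, fun n hn x y => ?_⟩
  have hn0 : 0 < n := by linarith
  have hs : 0 < (n ^ 2)⁻¹ := by positivity
  set s := (n ^ 2)⁻¹ with hs_def
  set Z : ℝ → ℂ := fun ξ => (2 * Real.pi * ξ : ℝ) * Complex.I with hZ
  have hZre : ∀ ξ, (Z ξ).re = 0 := fun ξ => by simp [hZ]
  have hZn : ∀ ξ, ‖Z ξ‖ = 2 * Real.pi * |ξ| := fun ξ => by
    simp only [hZ, norm_mul, Complex.norm_I, mul_one, Complex.norm_real, Real.norm_eq_abs,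
      abs_of_pos Real.pi_pos, abs_two]
  set B : ℕ → ℝ → ℂ := fun k ξ => (Real.exp (-(Ξ.lam k) ^ 2 * s) * Ξ.φ k x * Ξ.φ k y : ℝ) *
      Complex.exp (Z ξ * Real.exp (-(Ξ.lam k) ^ 2 * s)) with hB
  have hBc : ∀ k, Continuous (B k) := fun k => by simp only [hB, hZ]; fun_prop
  have hterm : ∀ k, ((h (Ξ.lam k / n) * Ξ.φ k x * Ξ.φ k y : ℝ) : ℂ) = ∫ ξ, g ξ * B k ξ := by
    intro k
    have e : -(Ξ.lam k / n) ^ 2 = -(Ξ.lam k) ^ 2 * s := by rw [hs_def, div_pow]; ring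
    have := hrep (Ξ.lam k / n) (div_nonneg (Ξ.lam_nonneg k) hn0.le)
    rw [e] at this
    push_cast
    rw [this, mul_assoc, mul_comm, ← integral_const_mul]
    congr 1
    ext ξ
    simp only [hB, hZ]
    push_cast
    ring
  -- Sum and integral are interchanged by domination: the modulus of each term is `‖g ξ‖` times a
  -- term of the absolute heat series.
  have hker : HasSum (fun k => ∫ ξ, g ξ * B k ξ) (∫ ξ, g ξ * Ξ.expKernel s (Z ξ) x y) := by
    refine hasSum_integral_of_dominated_convergence
      (fun k ξ => ‖g ξ‖ * (Real.exp (-(Ξ.lam k) ^ 2 * s) * |Ξ.φ k x| * |Ξ.φ k y|))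
      (fun k => hg.1.mul (hBc k).aestronglyMeasurable)
      (fun k => Eventually.of_forall fun ξ => ?_)
      (Eventually.of_forall fun ξ => (H.summable_abs hs x y).mul_left _) ?_
      (Eventually.of_forall fun ξ => (H.summable_expKernel hs (hZre ξ) x y).hasSum.mul_left _)
    · simp only [hB]
      rw [norm_mul, Ξ.norm_expKernel_term s (hZre ξ)]
    · simp_rw [tsum_mul_left]
      exact hg.norm.mul_const _
  have hkn : ‖∫ ξ, g ξ * Ξ.expKernel s (Z ξ) x y‖ = |Ξ.kernel h n x y| := by
    rw [← hker.tsum_eq]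
    simp_rw [← hterm]
    rw [← Complex.ofReal_tsum, Complex.norm_real, Real.norm_eq_abs]
    rfl
  rw [← hkn]
  have hw : 0 ≤ n * dist x y := by positivity
  have hpt : ∀ ξ, (1 + n * dist x y) ^ T * ‖g ξ * Ξ.expKernel s (Z ξ) x y‖ ≤
      D * n ^ q * ((1 + |ξ|) ^ T * ‖g ξ‖) := by
    intro ξ
    have b1 := H.norm_expKernel_le hs (inv_sq_le_one hn) (hZre ξ) x y
    rw [rpow_inv_sq hn0] at b1
    have b2 := hexp n hn (Z ξ) x y
    rw [hZn, ← mul_assoc] at b2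
    have := pow_mul_le_of_le_exp (A := κ₁ * n ^ q) (a := a) (C := C * n ^ q) (by positivity) ha0.le
      (by positivity) T hw (abs_nonneg ξ) (norm_nonneg _) b1 b2
    calc _ = ‖g ξ‖ * ((1 + n * dist x y) ^ T * ‖Ξ.expKernel s (Z ξ) x y‖) := by
          rw [norm_mul]; ring
      _ ≤ ‖g ξ‖ * ((κ₁ * n ^ q * (1 + 2 * a) ^ T +
          C * n ^ q * (2 ^ T * (T.factorial * Real.exp 1))) * (1 + |ξ|) ^ T) := by gcongr
      _ = _ := by rw [hD]; ring
  calc (1 + n * dist x y) ^ T * ‖∫ ξ, g ξ * Ξ.expKernel s (Z ξ) x y‖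
      ≤ (1 + n * dist x y) ^ T * ∫ ξ, ‖g ξ * Ξ.expKernel s (Z ξ) x y‖ := by
        gcongr; exact norm_integral_le_integral_norm _
    _ = ∫ ξ, (1 + n * dist x y) ^ T * ‖g ξ * Ξ.expKernel s (Z ξ) x y‖ :=
        (integral_const_mul _ _).symm
    _ ≤ ∫ ξ, D * n ^ q * ((1 + |ξ|) ^ T * ‖g ξ‖) :=
        integral_mono_of_nonneg (Eventually.of_forall fun ξ => by positivity)
          ((hgT T).const_mul _) (Eventually.of_forall hpt)
    _ = D * J * n ^ q := by rw [integral_const_mul]; ring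
    _ ≤ (D * J + 1) * n ^ q := by gcongr; linarith

end HeatBound

end DataSpace

/-! ### The operators `σ_n`: integral form, uniform boundedness, near-best approximation. -/

namespace DataSpace

variable {X : Type*} [MetricSpace X] [MeasurableSpace X]

theorem finite_lam_lt (Ξ : DataSpace X) (n : ℝ) : {k | Ξ.lam k < n}.Finite := by
  have h := Ξ.lam_tendsto.eventually_ge_atTop n
  rw [← Nat.cofinite_eq_atTop, eventually_cofinite] at h
  simpa using h

/-- The indices of the basis elements of `Π_n`. -/
def idx (Ξ : DataSpace X) (n : ℝ) : Finset ℕ := (Ξ.finite_lam_lt n).toFinset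

theorem mem_idx {Ξ : DataSpace X} {n : ℝ} {k : ℕ} : k ∈ Ξ.idx n ↔ Ξ.lam k < n := by
  simp [idx]

theorem lowPass_eq_zero (Ξ : DataSpace X) {h : ℝ → ℝ} (hh : IsLowPass h) {n : ℝ} (hn : 0 < n)
    {k : ℕ} (hk : k ∉ Ξ.idx n) : h (Ξ.lam k / n) = 0 := by
  rw [mem_idx, not_lt] at hk
  exact hh.eq_zero _ ((one_le_div hn).2 hk)

theorem sigma_eq_sum (Ξ : DataSpace X) {h : ℝ → ℝ} (hh : IsLowPass h) {n : ℝ} (hn : 0 < n)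
    (f : X → ℝ) (x : X) :
    Ξ.sigma h n f x = ∑ k ∈ Ξ.idx n, h (Ξ.lam k / n) * Ξ.coeff f k * Ξ.φ k x :=
  tsum_eq_sum fun k hk => by rw [Ξ.lowPass_eq_zero hh hn hk]; ring

theorem kernel_eq_sum (Ξ : DataSpace X) {h : ℝ → ℝ} (hh : IsLowPass h) {n : ℝ} (hn : 0 < n)
    (x y : X) :
    Ξ.kernel h n x y = ∑ k ∈ Ξ.idx n, h (Ξ.lam k / n) * Ξ.φ k x * Ξ.φ k y :=
  tsum_eq_sum fun k hk => by rw [Ξ.lowPass_eq_zero hh hn hk]; ring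

theorem exists_coeffs_of_mem_diffPoly {Ξ : DataSpace X} {m : ℝ} {P : X → ℝ} (hP : P ∈ Ξ.diffPoly m) :
    ∃ c : ℕ → ℝ, P = fun x => ∑ k ∈ Ξ.idx m, c k * Ξ.φ k x := by
  induction hP using Submodule.span_induction with
  | mem g hg =>
    obtain ⟨j, hj, rfl⟩ := hg
    refine ⟨fun k => if k = j then 1 else 0, funext fun x => ?_⟩
    simp [mem_idx, hj]
  | zero => exact ⟨0, by ext x; simp⟩
  | add f g _ _ hf hg =>
    obtain ⟨c, rfl⟩ := hf
    obtain ⟨d, rfl⟩ := hg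
    exact ⟨c + d, funext fun x => by simp [add_mul, Finset.sum_add_distrib]⟩
  | smul a f _ hf =>
    obtain ⟨c, rfl⟩ := hf
    exact ⟨a • c, funext fun x => by simp [Finset.mul_sum, mul_assoc]⟩

section

variable [BorelSpace X] (Ξ : DataSpace X)

theorem measurable_kernel {h : ℝ → ℝ} (hh : IsLowPass h) {n : ℝ} (hn : 0 < n) :
    Measurable fun z : X × X => Ξ.kernel h n z.1 z.2 := by
  simp_rw [Ξ.kernel_eq_sum hh hn]
  exact Finset.measurable_fun_sum _ fun k _ =>
    (((Ξ.measurable_φ k).comp measurable_fst).const_mul _).mul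
      ((Ξ.measurable_φ k).comp measurable_snd)

theorem memLp_top_φ (k : ℕ) : MemLp (fun x => Ξ.φ k x) ⊤ Ξ.μ :=
  memLp_top_of_bound (Ξ.measurable_φ k).aestronglyMeasurable ‖Ξ.φ k‖
    (Eventually.of_forall (Ξ.abs_φ_le k))

theorem memLp_φ (k : ℕ) {p : ℝ≥0∞} (hp : 1 ≤ p) : MemLp (fun x => Ξ.φ k x) p Ξ.μ :=
  ⟨(Ξ.measurable_φ k).aestronglyMeasurable,
    (eLpNorm_le_max_one_top hp (Ξ.measurable_φ k).aestronglyMeasurable).trans_lt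
      (max_lt (memLp_one_iff_integrable.2 (Ξ.φ_integrable k)).2 (Ξ.memLp_top_φ k).2)⟩

variable {Ξ}

theorem integrable_mul_φ {p : ℝ≥0∞} (hp : 1 ≤ p) {f : X → ℝ} (hf : MemLp f p Ξ.μ) (k : ℕ) :
    Integrable (fun y => f y * Ξ.φ k y) Ξ.μ := by
  have := ENNReal.HolderConjugate.conjExponent hp
  exact hf.integrable_mul (q := p.conjExponent)
    (Ξ.memLp_φ k (ENNReal.HolderConjugate.one_le p.conjExponent p))

/-- Hölder's inequality for the coefficients. -/
theorem enorm_coeff_le {p : ℝ≥0∞} (hp : 1 ≤ p) {f : X → ℝ} (hf : MemLp f p Ξ.μ) (k : ℕ) :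
    ‖Ξ.coeff f k‖ₑ ≤ eLpNorm f p Ξ.μ *
      max (eLpNorm (fun x => Ξ.φ k x) 1 Ξ.μ) (eLpNorm (fun x => Ξ.φ k x) ⊤ Ξ.μ) := by
  have := ENNReal.HolderConjugate.conjExponent hp
  have hm := (Ξ.measurable_φ k).aestronglyMeasurable (μ := Ξ.μ)
  calc ‖Ξ.coeff f k‖ₑ ≤ ∫⁻ y, ‖f y * Ξ.φ k y‖ₑ ∂Ξ.μ := enorm_integral_le_lintegral_enorm _
    _ = eLpNorm (f • fun x => Ξ.φ k x) 1 Ξ.μ := by rw [eLpNorm_one_eq_lintegral_enorm]; rfl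
    _ ≤ eLpNorm f p Ξ.μ * eLpNorm (fun x => Ξ.φ k x) p.conjExponent Ξ.μ :=
        eLpNorm_smul_le_mul_eLpNorm hm hf.1
    _ ≤ _ := by
        gcongr
        exact eLpNorm_le_max_one_top (ENNReal.HolderConjugate.one_le p.conjExponent p) hm

theorem coeff_sub {p : ℝ≥0∞} (hp : 1 ≤ p) {f g : X → ℝ} (hf : MemLp f p Ξ.μ)
    (hg : MemLp g p Ξ.μ) (k : ℕ) :
    Ξ.coeff (fun x => f x - g x) k = Ξ.coeff f k - Ξ.coeff g k := by
  simp only [coeff, sub_mul]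
  exact integral_sub (integrable_mul_φ hp hf k) (integrable_mul_φ hp hg k)

theorem sigma_sub {h : ℝ → ℝ} (hh : IsLowPass h) {n : ℝ} (hn : 0 < n) {p : ℝ≥0∞} (hp : 1 ≤ p)
    {f g : X → ℝ} (hf : MemLp f p Ξ.μ) (hg : MemLp g p Ξ.μ) (x : X) :
    Ξ.sigma h n (fun x => f x - g x) x = Ξ.sigma h n f x - Ξ.sigma h n g x := by
  simp only [Ξ.sigma_eq_sum hh hn, coeff_sub hp hf hg, ← Finset.sum_sub_distrib]
  exact Finset.sum_congr rfl fun k _ => by ring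

theorem measurable_sigma {h : ℝ → ℝ} (hh : IsLowPass h) {n : ℝ} (hn : 0 < n) (f : X → ℝ) :
    Measurable (Ξ.sigma h n f) := by
  have : Ξ.sigma h n f = fun x => ∑ k ∈ Ξ.idx n, h (Ξ.lam k / n) * Ξ.coeff f k * Ξ.φ k x :=
    funext fun x => Ξ.sigma_eq_sum hh hn f x
  rw [this]
  exact Finset.measurable_fun_sum _ fun k _ => (Ξ.measurable_φ k).const_mul _

theorem sigma_eq_integral {h : ℝ → ℝ} (hh : IsLowPass h) {n : ℝ} (hn : 0 < n) {p : ℝ≥0∞}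
    (hp : 1 ≤ p) {f : X → ℝ} (hf : MemLp f p Ξ.μ) (x : X) :
    Ξ.sigma h n f x = ∫ y, Ξ.kernel h n x y * f y ∂Ξ.μ := by
  simp only [Ξ.sigma_eq_sum hh hn, Ξ.kernel_eq_sum hh hn, Finset.sum_mul]
  rw [integral_finsetSum]
  · refine Finset.sum_congr rfl fun k _ => ?_
    rw [coeff, mul_right_comm, ← integral_const_mul]
    exact integral_congr_ae (Eventually.of_forall fun y => by ring)
  · intro k _
    refine ((integrable_mul_φ hp hf k).const_mul (h (Ξ.lam k / n) * Ξ.φ k x)).congr ?_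
    exact Eventually.of_forall fun y => by ring

theorem memLp_of_mem_diffPoly {m : ℝ} {P : X → ℝ} (hP : P ∈ Ξ.diffPoly m) {p : ℝ≥0∞}
    (hp : 1 ≤ p) : MemLp P p Ξ.μ := by
  obtain ⟨c, rfl⟩ := exists_coeffs_of_mem_diffPoly hP
  exact memLp_finsetSum _ fun k _ => (Ξ.memLp_φ k hp).const_mul _

/-- The filter is `1` on `[0, 1/2]`, so the coefficients of order below `n / 2` pass unchanged. -/
theorem sigma_diffPoly {h : ℝ → ℝ} (hh : IsLowPass h) {n : ℝ} (hn : 0 < n) {P : X → ℝ}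
    (hP : P ∈ Ξ.diffPoly (n / 2)) (x : X) : Ξ.sigma h n P x = P x := by
  obtain ⟨c, rfl⟩ := exists_coeffs_of_mem_diffPoly hP
  have hcoeff : ∀ j, Ξ.coeff (fun x => ∑ k ∈ Ξ.idx (n / 2), c k * Ξ.φ k x) j =
      if j ∈ Ξ.idx (n / 2) then c j else 0 := by
    intro j
    simp only [coeff, Finset.sum_mul, mul_assoc]
    rw [integral_finsetSum _ fun k _ =>
      (integrable_mul_φ le_rfl (Ξ.memLp_φ k le_rfl) j).const_mul (c k)]
    simp only [integral_const_mul, Ξ.φ_orthonormal, mul_ite, mul_one, mul_zero]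
    simp
  rw [Ξ.sigma_eq_sum hh hn]
  simp only [hcoeff]
  have hsub : Ξ.idx (n / 2) ⊆ Ξ.idx n := fun k hk => by
    rw [mem_idx] at hk ⊢
    linarith
  rw [← Finset.sum_subset hsub fun k _ hk => by simp [hk]]
  refine Finset.sum_congr rfl fun k hk => ?_
  rw [if_pos hk, hh.eq_one, one_mul]
  rw [mem_idx] at hk
  rw [abs_of_nonneg (div_nonneg (Ξ.lam_nonneg k) hn.le), div_le_iff₀ hn]
  linarith

end

namespace HeatBound

variable {Ξ : DataSpace X} {q κ κ₁ κ₂ : ℝ} [BorelSpace X]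

/-- Integral bound for the part of the summability kernel away from the diagonal. -/
theorem exists_lintegral_kernel_far_le (H : Ξ.HeatBound q κ κ₁ κ₂) {h : ℝ → ℝ}
    (hh : IsLowPass h) (S : ℕ) :
    ∃ C : ℝ, 0 < C ∧ ∀ n : ℝ, 1 ≤ n → ∀ δ : ℝ, 0 ≤ δ → ∀ x : X,
      ∫⁻ y, (if δ ≤ dist x y then ‖Ξ.kernel h n x y‖ₑ else 0) ∂Ξ.μ
        ≤ ENNReal.ofReal (C * ((1 + n * δ) ^ S)⁻¹) := by
  obtain ⟨C₁, hC₁, hI⟩ := H.lintegral_inv_pow_le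
  obtain ⟨C₂, hC₂, hK⟩ := H.exists_kernel_localized hh (⌈q⌉₊ + 2 + S)
  -- `N` of the `N + S` powers of decay make the kernel integrable; the other `S` are bounded by
  -- their value at distance `δ`.
  set N := ⌈q⌉₊ + 2
  refine ⟨C₂ * C₁, by positivity, fun n hn δ hδ x => ?_⟩
  have hn0 : 0 < n := by linarith
  calc _ ≤ ∫⁻ y, ENNReal.ofReal (C₂ * n ^ q * ((1 + n * δ) ^ S)⁻¹) *
        ENNReal.ofReal (((1 + n * dist x y) ^ N)⁻¹) ∂Ξ.μ := by
        refine lintegral_mono fun y => ?_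
        split_ifs with hd
        · rw [Real.enorm_eq_ofReal_abs, ← ENNReal.ofReal_mul (by positivity)]
          apply ENNReal.ofReal_le_ofReal
          have h1 := hK n hn x y
          rw [pow_add] at h1
          calc |Ξ.kernel h n x y| ≤ C₂ * n ^ q / ((1 + n * dist x y) ^ N *
                (1 + n * dist x y) ^ S) := by
                rw [le_div_iff₀ (by positivity), mul_comm]; exact h1
            _ = C₂ * n ^ q * ((1 + n * dist x y) ^ S)⁻¹ * ((1 + n * dist x y) ^ N)⁻¹ := by
                field_simp
            _ ≤ _ := by gcongr
        · exact zero_le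
    _ = ENNReal.ofReal (C₂ * n ^ q * ((1 + n * δ) ^ S)⁻¹) *
        ∫⁻ y, ENNReal.ofReal (((1 + n * dist x y) ^ N)⁻¹) ∂Ξ.μ :=
        lintegral_const_mul' _ _ ENNReal.ofReal_ne_top
    _ ≤ ENNReal.ofReal (C₂ * n ^ q * ((1 + n * δ) ^ S)⁻¹) * ENNReal.ofReal (C₁ * n ^ (-q)) := by
        gcongr; exact hI n hn0 x
    _ = ENNReal.ofReal (C₂ * C₁ * ((1 + n * δ) ^ S)⁻¹) := by
        rw [← ENNReal.ofReal_mul (by positivity)]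
        have hnq : n ^ q * n ^ (-q) = 1 := by
          rw [← Real.rpow_add hn0]; simp
        congr 1
        linear_combination C₂ * C₁ * ((1 + n * δ) ^ S)⁻¹ * hnq

/-- The part of `σ_n(f)` produced by values of `f` at distance at least `δ`. -/
theorem exists_eLpNorm_sigma_le (H : Ξ.HeatBound q κ κ₁ κ₂) {h : ℝ → ℝ}
    (hh : IsLowPass h) (S : ℕ) :
    ∃ C : ℝ, 0 < C ∧ ∀ n : ℝ, 1 ≤ n → ∀ δ : ℝ, 0 ≤ δ → ∀ p : ℝ≥0∞, 1 ≤ p → ∀ f : X → ℝ,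
      MemLp f p Ξ.μ → ∀ A : Set X, MeasurableSet A → (∀ x ∈ A, ∀ y, dist x y < δ → f y = 0) →
        eLpNorm (Ξ.sigma h n f) p (Ξ.μ.restrict A)
          ≤ ENNReal.ofReal (C * ((1 + n * δ) ^ S)⁻¹) * eLpNorm f p Ξ.μ := by
  obtain ⟨C, hC, hI⟩ := H.exists_lintegral_kernel_far_le hh S
  refine ⟨C, hC, fun n hn δ hδ p hp f hf A hA hfA => ?_⟩
  have hn0 : 0 < n := by linarith
  have := Ξ.secondCountable
  have := Ξ.sigmaFinite
  -- On `A` the integral for `σ_n(f)` sees only points at distance at least `δ`, so the kernel may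
  -- be truncated. The truncation is symmetric, and one estimate supplies both hypotheses of Schur's
  -- test.
  set K : X → X → ℝ≥0∞ := fun x y => if δ ≤ dist x y then ‖Ξ.kernel h n x y‖ₑ else 0 with hKdef
  rw [← eLpNorm_indicator_eq_eLpNorm_restrict hA]
  refine eLpNorm_le_of_kernel (K := K) ?_ (hI n hn δ hδ) (fun y => ?_) hp hf.1 fun x => ?_
  · exact Measurable.ite (measurableSet_le measurable_const measurable_dist)
      (Ξ.measurable_kernel hh hn0).enorm measurable_const
  · simp only [hKdef]
    simp_rw [dist_comm _ y, Ξ.kernel_comm h n _ y]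
    exact hI n hn δ hδ y
  · by_cases hx : x ∈ A
    · rw [Set.indicator_of_mem hx, sigma_eq_integral hh hn0 hp hf]
      refine (enorm_integral_le_lintegral_enorm _).trans (lintegral_mono fun y => ?_)
      simp only [hKdef]
      split_ifs with hd
      · rw [enorm_mul]
      · rw [hfA x hx y (not_le.1 hd), mul_zero, enorm_zero]
        exact zero_le
    · rw [Set.indicator_of_notMem hx, enorm_zero]
      exact zero_le

/-- The operators `σ_n` are uniformly bounded on `L^p`. -/
theorem exists_eLpNorm_sigma_le_mul (H : Ξ.HeatBound q κ κ₁ κ₂) {h : ℝ → ℝ}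
    (hh : IsLowPass h) :
    ∃ C : ℝ, 0 < C ∧ ∀ n : ℝ, 1 ≤ n → ∀ p : ℝ≥0∞, 1 ≤ p → ∀ f : X → ℝ,
      MemLp f p Ξ.μ → eLpNorm (Ξ.sigma h n f) p Ξ.μ ≤ ENNReal.ofReal C * eLpNorm f p Ξ.μ := by
  obtain ⟨C, hC, hI⟩ := H.exists_eLpNorm_sigma_le hh 0
  refine ⟨C, hC, fun n hn p hp f hf => ?_⟩
  simpa using hI n hn 0 le_rfl p hp f hf Set.univ MeasurableSet.univ
    fun x _ y hy => absurd hy (not_lt.2 dist_nonneg)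

/-- The operators `σ_n` yield near-best approximations. -/
theorem exists_eLpNorm_sub_sigma_le (H : Ξ.HeatBound q κ κ₁ κ₂) {h : ℝ → ℝ}
    (hh : IsLowPass h) :
    ∃ C : ℝ, 0 < C ∧ ∀ n : ℝ, 1 ≤ n → ∀ p : ℝ≥0∞, 1 ≤ p → ∀ f : X → ℝ,
      MemLp f p Ξ.μ → eLpNorm (fun x => f x - Ξ.sigma h n f x) p Ξ.μ ≤
        ENNReal.ofReal C * Ξ.degApprox (fun _ => 1) (n / 2) p f := by
  obtain ⟨C, hC, hI⟩ := H.exists_eLpNorm_sigma_le_mul hh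
  refine ⟨1 + C, by positivity, fun n hn p hp f hf => ?_⟩
  have hn0 : 0 < n := by linarith
  have hc : ENNReal.ofReal (1 + C) ≠ 0 := by
    rw [Ne, ENNReal.ofReal_eq_zero, not_le]; positivity
  -- The constant moves to the left so that the infimum over `P` stands alone and can be tested on
  -- each `P`.
  rw [← ENNReal.div_le_iff' hc ENNReal.ofReal_ne_top]
  refine le_iInf₂ fun P hP => ?_
  rw [ENNReal.div_le_iff' hc ENNReal.ofReal_ne_top]
  have hPm := memLp_of_mem_diffPoly hP hp
  have hfP : MemLp (fun x => f x - P x) p Ξ.μ := hf.sub hPm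
  simp only [mul_one]
  -- `P` is reproduced by `σ_n`, so the error is unchanged when `P` is subtracted from `f`.
  have e : (fun x => f x - Ξ.sigma h n f x) =
      (fun x => f x - P x) - Ξ.sigma h n (fun x => f x - P x) := by
    ext x
    simp only [Pi.sub_apply]
    rw [sigma_sub hh hn0 hp hf hPm, sigma_diffPoly hh hn0 hP]
    ring
  rw [e]
  calc _ ≤ eLpNorm (fun x => f x - P x) p Ξ.μ +
        eLpNorm (Ξ.sigma h n (fun x => f x - P x)) p Ξ.μ :=
        eLpNorm_sub_le hfP.1 (measurable_sigma hh hn0 _).aestronglyMeasurable hp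
    _ ≤ eLpNorm (fun x => f x - P x) p Ξ.μ +
        ENNReal.ofReal C * eLpNorm (fun x => f x - P x) p Ξ.μ := by
        gcongr; exact hI n hn p hp _ hfP
    _ = _ := by
        rw [ENNReal.ofReal_add zero_le_one hC.le, ENNReal.ofReal_one, add_mul, one_mul]

end HeatBound

end DataSpace

/-! ### Telescoping and the equivalence of the local rates. -/

/-- A telescoping estimate for geometrically weighted suprema. -/
theorem iSup_pow_mul_le_of_telescope {b : ℝ≥0∞} (hb0 : b ≠ 0) (hbt : b ≠ ⊤) {a e : ℕ → ℝ≥0∞}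
    (he : ∀ n, e n ≤ a (n + 1) + e (n + 1)) (ht : Tendsto e atTop (𝓝 0)) :
    ⨆ n, b ^ n * e n ≤ (1 - b⁻¹)⁻¹ * ⨆ (j : ℕ) (_ : 1 ≤ j), b ^ j * a j := by
  set T := ⨆ (j : ℕ) (_ : 1 ≤ j), b ^ j * a j
  have hbb : b⁻¹ * b = 1 := ENNReal.inv_mul_cancel hb0 hbt
  refine iSup_le fun n => ?_
  have step : ∀ m, b ^ n * a (n + m + 1) ≤ b⁻¹ ^ (m + 1) * T := by
    intro m
    calc b ^ n * a (n + m + 1) = b⁻¹ ^ (m + 1) * (b ^ (n + m + 1) * a (n + m + 1)) := by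
          rw [add_assoc, pow_add b, mul_comm (b ^ n) (b ^ (m + 1)), ← mul_assoc, ← mul_assoc,
            ← mul_pow, hbb, one_pow, one_mul]
      _ ≤ _ := by
          gcongr
          exact le_iSup₂ (f := fun (j : ℕ) (_ : 1 ≤ j) => b ^ j * a j) (n + m + 1) (by omega)
  have ind : ∀ m, b ^ n * e n ≤ (∑ i ∈ Finset.range m, b⁻¹ ^ (i + 1)) * T + b ^ n * e (n + m) := by
    intro m
    induction m with
    | zero => simp
    | succ m ih =>
      calc b ^ n * e n ≤ (∑ i ∈ Finset.range m, b⁻¹ ^ (i + 1)) * T + b ^ n * e (n + m) := ih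
        _ ≤ (∑ i ∈ Finset.range m, b⁻¹ ^ (i + 1)) * T +
            b ^ n * (a (n + m + 1) + e (n + m + 1)) := by
            gcongr; exact he _
        _ ≤ (∑ i ∈ Finset.range m, b⁻¹ ^ (i + 1)) * T +
            (b⁻¹ ^ (m + 1) * T + b ^ n * e (n + m + 1)) := by
            rw [mul_add]; exact add_le_add le_rfl (add_le_add (step m) le_rfl)
        _ = _ := by rw [Finset.sum_range_succ, add_mul, add_assoc, add_assoc]
  have geo : ∀ m, ∑ i ∈ Finset.range m, b⁻¹ ^ (i + 1) ≤ (1 - b⁻¹)⁻¹ := by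
    intro m
    calc ∑ i ∈ Finset.range m, b⁻¹ ^ (i + 1) ≤ ∑' i : ℕ, b⁻¹ ^ (i + 1) := ENNReal.sum_le_tsum _
      _ ≤ ∑' i : ℕ, b⁻¹ ^ i :=
          ENNReal.tsum_comp_le_tsum_of_injective (add_left_injective 1) (fun i => b⁻¹ ^ i)
      _ = _ := ENNReal.tsum_geometric _
  -- For fixed `n` the remainder `b ^ n * e (n + m)` disappears as `m → ∞`; without convergence of
  -- the errors to zero, the differences could not control them.
  have lim : Tendsto (fun m => (1 - b⁻¹)⁻¹ * T + b ^ n * e (n + m)) atTop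
      (𝓝 ((1 - b⁻¹)⁻¹ * T + b ^ n * 0)) := by
    refine tendsto_const_nhds.add (ENNReal.Tendsto.const_mul ?_
      (Or.inr (ENNReal.pow_ne_top hbt)))
    simpa [add_comm] using (tendsto_add_atTop_iff_nat n).2 ht
  rw [mul_zero, add_zero] at lim
  refine ge_of_tendsto' lim fun m => (ind m).trans ?_
  gcongr
  exact geo m

theorem ofReal_two_rpow_mul (γ : ℝ) (j : ℕ) :
    ENNReal.ofReal ((2 : ℝ) ^ ((j : ℝ) * γ)) = ENNReal.ofReal ((2 : ℝ) ^ γ) ^ j := by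
  rw [← ENNReal.ofReal_pow (by positivity), mul_comm, Real.rpow_mul (by norm_num),
    Real.rpow_natCast]

theorem two_pow_rpow (γ : ℝ) (j : ℕ) : ((2 : ℝ) ^ j) ^ γ = (2 : ℝ) ^ ((j : ℝ) * γ) := by
  rw [Real.rpow_mul (by norm_num), Real.rpow_natCast]

namespace DataSpace

variable {X : Type*} [MetricSpace X] [MeasurableSpace X]

theorem errorRate_eq (Ξ : DataSpace X) (h : ℝ → ℝ) (γ : ℝ) (p : ℝ≥0∞) (B : Set X) (f : X → ℝ) :
    Ξ.errorRate h γ p B f = ⨆ n : ℕ, ENNReal.ofReal ((2 : ℝ) ^ γ) ^ n *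
      Ξ.normOn p B (fun x => f x - Ξ.sigma h (2 ^ n) f x) := by
  simp only [errorRate, ofReal_two_rpow_mul]

theorem tauRate_eq (Ξ : DataSpace X) (h : ℝ → ℝ) (γ : ℝ) (p : ℝ≥0∞) (B : Set X) (j₀ : ℕ)
    (f : X → ℝ) :
    Ξ.tauRate h γ p B j₀ f = ⨆ (j : ℕ) (_ : j₀ ≤ j), ENNReal.ofReal ((2 : ℝ) ^ γ) ^ j *
      Ξ.normOn p B (Ξ.tau h j f) := by
  simp only [tauRate, ofReal_two_rpow_mul]

section

variable {Ξ : DataSpace X} {h : ℝ → ℝ} {p : ℝ≥0∞} {f : X → ℝ} {γ : ℝ} (B : Set X)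

theorem normOn_sub_sigma_one_le_errorRate :
    Ξ.normOn p B (fun x => f x - Ξ.sigma h (2 ^ 0) f x) ≤ Ξ.errorRate h γ p B f := by
  rw [errorRate_eq]
  simpa using le_iSup (fun n : ℕ => ENNReal.ofReal ((2 : ℝ) ^ γ) ^ n *
      Ξ.normOn p B (fun x => f x - Ξ.sigma h (2 ^ n) f x)) 0

theorem tauRate_one_le_zero : Ξ.tauRate h γ p B 1 f ≤ Ξ.tauRate h γ p B 0 f :=
  iSup₂_le fun j _ => le_iSup₂ (f := fun (j : ℕ) (_ : 0 ≤ j) =>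
    ENNReal.ofReal ((2 : ℝ) ^ ((j : ℝ) * γ)) * Ξ.normOn p B (Ξ.tau h j f)) j (Nat.zero_le j)

theorem normOn_tau_zero_le_tauRate : Ξ.normOn p B (Ξ.tau h 0 f) ≤ Ξ.tauRate h γ p B 0 f := by
  exact (by simp : _ ≤ _).trans (le_iSup₂ (f := fun (j : ℕ) (_ : 0 ≤ j) =>
    ENNReal.ofReal ((2 : ℝ) ^ ((j : ℝ) * γ)) * Ξ.normOn p B (Ξ.tau h j f)) 0 le_rfl)

theorem tauRate_zero_le_max :
    Ξ.tauRate h γ p B 0 f ≤ max (Ξ.normOn p B (Ξ.tau h 0 f)) (Ξ.tauRate h γ p B 1 f) := by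
  refine iSup₂_le fun j _ => ?_
  rcases Nat.eq_zero_or_pos j with rfl | hj
  · exact le_max_of_le_left (by simp)
  · exact le_max_of_le_right (le_iSup₂ (f := fun (j : ℕ) (_ : 1 ≤ j) =>
      ENNReal.ofReal ((2 : ℝ) ^ ((j : ℝ) * γ)) * Ξ.normOn p B (Ξ.tau h j f)) j hj)

end

theorem memSmooth_zero {Ξ : DataSpace X} : Ξ.MemSmooth (fun _ => 0) := by
  refine fun γ _ => ⟨MemLp.zero', ?_⟩
  have hz : eLpNorm (fun _ : X => (0 : ℝ)) ⊤ Ξ.μ = 0 := eLpNorm_zero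
  have : ∀ n, Ξ.degApprox (fun _ => 1) n ⊤ (fun _ => 0) = 0 := fun n =>
    le_antisymm ((iInf₂_le 0 (zero_mem _)).trans_eq
      (by simpa only [Pi.zero_apply, zero_mul, sub_zero] using hz)) zero_le
  simp only [sobolevNorm, this, hz, mul_zero, ENNReal.iSup_zero, add_zero, ENNReal.zero_lt_top]

variable [BorelSpace X] {Ξ : DataSpace X}

section LocalRates

variable {h : ℝ → ℝ} {p : ℝ≥0∞} {f : X → ℝ} (B : Set X)

theorem aestronglyMeasurable_sub_sigma (hh : IsLowPass h) (hf : MemLp f p Ξ.μ) {n : ℝ}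
    (hn : 0 < n) : AEStronglyMeasurable (fun x => f x - Ξ.sigma h n f x) (Ξ.μ.restrict B) :=
  hf.1.restrict.sub (measurable_sigma hh hn f).aestronglyMeasurable

theorem measurable_tau (hh : IsLowPass h) (f : X → ℝ) (j : ℕ) : Measurable (Ξ.tau h j f) := by
  cases j with
  | zero => exact measurable_sigma hh one_pos f
  | succ j => exact (measurable_sigma hh (by positivity) f).sub (measurable_sigma hh (by positivity) f)

theorem normOn_sub_sigma_le_tau_add (hh : IsLowPass h) (hp : 1 ≤ p) (hf : MemLp f p Ξ.μ) (n : ℕ) :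
    Ξ.normOn p B (fun x => f x - Ξ.sigma h (2 ^ n) f x) ≤
      Ξ.normOn p B (Ξ.tau h (n + 1) f) +
        Ξ.normOn p B (fun x => f x - Ξ.sigma h (2 ^ (n + 1)) f x) := by
  refine le_trans (le_of_eq ?_) (eLpNorm_add_le (measurable_tau hh f _).aestronglyMeasurable
    (aestronglyMeasurable_sub_sigma B hh hf (by positivity)) hp)
  unfold normOn
  congr 1
  ext x
  simp [tau]

theorem normOn_tau_succ_le (hh : IsLowPass h) (hp : 1 ≤ p) (hf : MemLp f p Ξ.μ) (n : ℕ) :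
    Ξ.normOn p B (Ξ.tau h (n + 1) f) ≤ Ξ.normOn p B (fun x => f x - Ξ.sigma h (2 ^ n) f x) +
        Ξ.normOn p B (fun x => f x - Ξ.sigma h (2 ^ (n + 1)) f x) := by
  refine le_trans (le_of_eq ?_) (eLpNorm_sub_le
    (aestronglyMeasurable_sub_sigma B hh hf (by positivity))
    (aestronglyMeasurable_sub_sigma B hh hf (by positivity)) hp)
  unfold normOn
  congr 1
  ext x
  simp [tau]

theorem normOn_tau_zero_le (hh : IsLowPass h) (hp : 1 ≤ p) (hf : MemLp f p Ξ.μ) :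
    Ξ.normOn p B (Ξ.tau h 0 f) ≤ Ξ.normOn p B f +
        Ξ.normOn p B (fun x => f x - Ξ.sigma h (2 ^ 0) f x) := by
  refine le_trans (le_of_eq ?_) (eLpNorm_sub_le hf.1.restrict
    (aestronglyMeasurable_sub_sigma B hh hf (by positivity)) hp)
  unfold normOn
  congr 1
  ext x
  simp [tau]

theorem normOn_le_tau_zero_add (hh : IsLowPass h) (hp : 1 ≤ p) (hf : MemLp f p Ξ.μ) :
    Ξ.normOn p B f ≤ Ξ.normOn p B (Ξ.tau h 0 f) +
        Ξ.normOn p B (fun x => f x - Ξ.sigma h (2 ^ 0) f x) := by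
  refine le_trans (le_of_eq ?_) (eLpNorm_add_le (measurable_tau hh f 0).aestronglyMeasurable
    (aestronglyMeasurable_sub_sigma B hh hf (by positivity)) hp)
  unfold normOn
  congr 1
  ext x
  simp [tau]

/-- This is where membership in `X^p` enters: near-best approximation turns `E_n → 0` into
convergence of `σ_{2^n}`, and restriction to `B` only lowers norms. -/
theorem tendsto_normOn_sub_sigma (hh : IsLowPass h) (hp : 1 ≤ p) (hf : Ξ.MemXp p f) :
    Tendsto (fun n : ℕ => Ξ.normOn p B (fun x => f x - Ξ.sigma h (2 ^ n) f x)) atTop (𝓝 0) := by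
  obtain ⟨q, κ, κ₁, κ₂, H⟩ := Ξ.exists_heatBound
  obtain ⟨C, hC, hI⟩ := H.exists_eLpNorm_sub_sigma_le hh
  have h2 : Tendsto (fun n : ℕ => (2 : ℝ) ^ n / 2) atTop atTop :=
    (tendsto_pow_atTop_atTop_of_one_lt one_lt_two).atTop_div_const two_pos
  have h3 : Tendsto (fun n : ℕ => ENNReal.ofReal C *
      Ξ.degApprox (fun _ => 1) ((2 : ℝ) ^ n / 2) p f) atTop (𝓝 (ENNReal.ofReal C * 0)) :=
    ENNReal.Tendsto.const_mul (hf.2.comp h2) (Or.inr ENNReal.ofReal_ne_top)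
  rw [mul_zero] at h3
  refine tendsto_of_tendsto_of_tendsto_of_le_of_le tendsto_const_nhds h3 (fun _ => zero_le)
    fun n => ?_
  exact (eLpNorm_mono_measure _ Measure.restrict_le_self).trans
    (hI _ (one_le_pow₀ one_le_two) p hp f hf.1)

end LocalRates

section

variable {h : ℝ → ℝ} {p : ℝ≥0∞} {f : X → ℝ} {γ : ℝ} (B : Set X)

theorem errorRate_le_tauRate (hh : IsLowPass h) (hp : 1 ≤ p) (hf : Ξ.MemXp p f) :
    Ξ.errorRate h γ p B f ≤
      (1 - (ENNReal.ofReal ((2 : ℝ) ^ γ))⁻¹)⁻¹ * Ξ.tauRate h γ p B 1 f := by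
  rw [errorRate_eq, tauRate_eq]
  refine iSup_pow_mul_le_of_telescope ?_ ENNReal.ofReal_ne_top
    (fun n => normOn_sub_sigma_le_tau_add B hh hp hf.1 n) (tendsto_normOn_sub_sigma B hh hp hf)
  rw [Ne, ENNReal.ofReal_eq_zero, not_le]
  positivity

theorem tauRate_one_le_errorRate (hh : IsLowPass h) (hp : 1 ≤ p) (hf : MemLp f p Ξ.μ) :
    Ξ.tauRate h γ p B 1 f ≤ (1 + ENNReal.ofReal ((2 : ℝ) ^ γ)) * Ξ.errorRate h γ p B f := by
  rw [errorRate_eq, tauRate_eq]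
  set b := ENNReal.ofReal ((2 : ℝ) ^ γ)
  set e := fun n : ℕ => Ξ.normOn p B (fun x => f x - Ξ.sigma h (2 ^ n) f x) with he
  have hle : ∀ n, b ^ n * e n ≤ ⨆ n, b ^ n * e n := le_iSup (fun n => b ^ n * e n)
  refine iSup₂_le fun j hj => ?_
  obtain ⟨n, rfl⟩ : ∃ n, j = n + 1 := ⟨j - 1, by omega⟩
  calc b ^ (n + 1) * Ξ.normOn p B (Ξ.tau h (n + 1) f) ≤ b ^ (n + 1) * (e n + e (n + 1)) := by
        gcongr; exact normOn_tau_succ_le B hh hp hf n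
    _ = b * (b ^ n * e n) + b ^ (n + 1) * e (n + 1) := by ring
    _ ≤ b * (⨆ n, b ^ n * e n) + ⨆ n, b ^ n * e n := by
        gcongr
        · exact hle n
        · exact hle (n + 1)
    _ = _ := by ring

theorem tauRate_zero_le (hh : IsLowPass h) (hp : 1 ≤ p) (hf : MemLp f p Ξ.μ) :
    Ξ.tauRate h γ p B 0 f ≤ (1 + ENNReal.ofReal ((2 : ℝ) ^ γ)) *
      (Ξ.normOn p B f + Ξ.errorRate h γ p B f) := by
  refine (tauRate_zero_le_max B).trans (max_le ?_ ?_)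
  · refine (normOn_tau_zero_le B hh hp hf).trans ?_
    rw [add_mul, one_mul]
    exact le_add_right (add_le_add le_rfl (normOn_sub_sigma_one_le_errorRate B))
  · refine (tauRate_one_le_errorRate B hh hp hf).trans ?_
    gcongr
    exact le_add_self

theorem normOn_add_errorRate_le (hh : IsLowPass h) (hp : 1 ≤ p) (hf : Ξ.MemXp p f) :
    Ξ.normOn p B f + Ξ.errorRate h γ p B f ≤
      (1 + 2 * (1 - (ENNReal.ofReal ((2 : ℝ) ^ γ))⁻¹)⁻¹) * Ξ.tauRate h γ p B 0 f := by
  set c := (1 - (ENNReal.ofReal ((2 : ℝ) ^ γ))⁻¹)⁻¹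
  set T := Ξ.tauRate h γ p B 0 f
  have h1 : Ξ.errorRate h γ p B f ≤ c * T :=
    (errorRate_le_tauRate B hh hp hf).trans (by gcongr; exact tauRate_one_le_zero B)
  -- The error rate occurs twice, once for itself and once through `f = τ_0(f) + (f - σ_1(f))`;
  -- hence the factor `2` in the constant.
  calc _ ≤ Ξ.normOn p B (Ξ.tau h 0 f) + Ξ.errorRate h γ p B f + Ξ.errorRate h γ p B f := by
        gcongr
        exact (normOn_le_tau_zero_add B hh hp hf.1).trans
          (add_le_add le_rfl (normOn_sub_sigma_one_le_errorRate B))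
    _ ≤ T + c * T + c * T := by
        gcongr
        exact normOn_tau_zero_le_tauRate B
    _ = _ := by ring

end

/-- Equivalence of the local rates, with constants depending only on `γ`. -/
theorem exists_rate_constants {γ : ℝ} (hγ : 0 < γ) :
    ∃ c₁ c₂ : ℝ, 0 < c₁ ∧ 0 < c₂ ∧ ∀ {X : Type*} [MetricSpace X] [MeasurableSpace X]
      [BorelSpace X] {Ξ : DataSpace X} {h : ℝ → ℝ}, IsLowPass h → ∀ (p : ℝ≥0∞), 1 ≤ p →
      ∀ f : X → ℝ, Ξ.MemXp p f → ∀ B : Set X,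
        (ENNReal.ofReal c₁ * Ξ.errorRate h γ p B f ≤ Ξ.tauRate h γ p B 1 f ∧
          Ξ.tauRate h γ p B 1 f ≤ ENNReal.ofReal c₂ * Ξ.errorRate h γ p B f) ∧
        (ENNReal.ofReal c₁ * (Ξ.normOn p B f + Ξ.errorRate h γ p B f) ≤ Ξ.tauRate h γ p B 0 f ∧
          Ξ.tauRate h γ p B 0 f ≤
            ENNReal.ofReal c₂ * (Ξ.normOn p B f + Ξ.errorRate h γ p B f)) := by
  have hb1 : (1 : ℝ) < 2 ^ γ := Real.one_lt_rpow one_lt_two hγ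
  set b := ENNReal.ofReal ((2 : ℝ) ^ γ) with hb
  set c := (1 - b⁻¹)⁻¹ with hc
  -- Here `γ > 0` is needed: the geometric series with ratio `2^(-γ)` must converge.
  have hbi : b⁻¹ < 1 := by
    rw [ENNReal.inv_lt_one, hb, ← ENNReal.ofReal_one]
    exact (ENNReal.ofReal_lt_ofReal_iff (by positivity)).2 hb1
  have hct : c ≠ ⊤ := by
    rw [hc, Ne, ENNReal.inv_eq_top, tsub_eq_zero_iff_le, not_le]
    exact hbi
  set D := 1 + 2 * c with hD
  have hDt : D ≠ ⊤ := by
    rw [hD]; exact ENNReal.add_ne_top.2 ⟨ENNReal.one_ne_top, ENNReal.mul_ne_top (by simp) hct⟩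
  have hD0 : D ≠ 0 := by rw [hD]; simp
  have hDr : 0 < D.toReal := ENNReal.toReal_pos hD0 hDt
  have hDi : ENNReal.ofReal D.toReal⁻¹ = D⁻¹ := by
    rw [ENNReal.ofReal_inv_of_pos hDr, ENNReal.ofReal_toReal hDt]
  have hB : ENNReal.ofReal (1 + 2 ^ γ) = 1 + b := by
    rw [ENNReal.ofReal_add zero_le_one (by positivity), ENNReal.ofReal_one]
  refine ⟨D.toReal⁻¹, 1 + 2 ^ γ, by positivity, by positivity, ?_⟩
  intro X _ _ _ Ξ h hh p hp f hf B
  rw [hDi, hB]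
  refine ⟨⟨?_, tauRate_one_le_errorRate B hh hp hf.1⟩, ?_, tauRate_zero_le B hh hp hf.1⟩
  · rw [ENNReal.inv_mul_le_iff hD0 hDt]
    refine (errorRate_le_tauRate B hh hp hf).trans ?_
    gcongr
    rw [hD, two_mul]
    exact le_add_left (le_add_left le_rfl)
  · rw [ENNReal.inv_mul_le_iff hD0 hDt]
    exact normOn_add_errorRate_le B hh hp hf

/-! ### Smooth cutoff functions. -/

section Smooth

theorem degApprox_add_le {f g : X → ℝ} {p : ℝ≥0∞} (hp : 1 ≤ p) (hf : MemLp f p Ξ.μ)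
    (hg : MemLp g p Ξ.μ) (n : ℝ) :
    Ξ.degApprox (fun _ => 1) n p (fun x => f x + g x) ≤
      Ξ.degApprox (fun _ => 1) n p f + Ξ.degApprox (fun _ => 1) n p g := by
  unfold degApprox
  simp only [ENNReal.iInf_add, ENNReal.add_iInf]
  refine le_iInf₂ fun Q hQ => le_iInf₂ fun P hP => ?_
  refine (iInf₂_le (P + Q) (add_mem hP hQ)).trans ?_
  refine le_trans (le_of_eq ?_) (eLpNorm_add_le
    (hf.1.sub ((memLp_of_mem_diffPoly hP hp).1.mul_const 1))
    (hg.1.sub ((memLp_of_mem_diffPoly hQ hp).1.mul_const 1)) hp)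
  congr 1
  ext x
  simp only [Pi.add_apply]
  ring

theorem MemSobolev.add {f g : X → ℝ} {p : ℝ≥0∞} (hp : 1 ≤ p) {γ : ℝ}
    (hf : Ξ.MemSobolev γ p (fun _ => 1) f) (hg : Ξ.MemSobolev γ p (fun _ => 1) g) :
    Ξ.MemSobolev γ p (fun _ => 1) (fun x => f x + g x) := by
  have hfg : MemLp (fun x => f x + g x) p Ξ.μ := hf.1.add hg.1
  refine ⟨hfg, ENNReal.add_lt_top.2 ⟨hfg.2, ?_⟩⟩
  refine lt_of_le_of_lt (iSup₂_le fun n hn => ?_) (ENNReal.add_lt_top.2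
    ⟨(ENNReal.add_lt_top.1 hf.2).2, (ENNReal.add_lt_top.1 hg.2).2⟩)
  refine (mul_le_mul_right (degApprox_add_le hp hf.1 hg.1 n) _).trans ?_
  rw [mul_add]
  exact add_le_add
    (le_iSup₂ (f := fun (n : ℝ) (_ : 0 < n) => ENNReal.ofReal (n ^ γ) *
      Ξ.degApprox (fun _ => 1) n p f) n hn)
    (le_iSup₂ (f := fun (n : ℝ) (_ : 0 < n) => ENNReal.ofReal (n ^ γ) *
      Ξ.degApprox (fun _ => 1) n p g) n hn)

theorem memSmooth_sum {ι : Type*} (F : Finset ι) {ψ : ι → X → ℝ} (hψ : ∀ i ∈ F, Ξ.MemSmooth (ψ i)) :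
    Ξ.MemSmooth (fun x => ∑ i ∈ F, ψ i x) := by
  classical
  induction F using Finset.induction_on with
  | empty => simpa using memSmooth_zero
  | insert i F hi ih =>
    simp only [Finset.sum_insert hi]
    exact fun γ hγ => (hψ i (Finset.mem_insert_self _ _) γ hγ).add le_top
      (ih (fun j hj => hψ j (Finset.mem_insert_of_mem hj)) γ hγ)

/-- Smooth cutoff functions from the partition of unity. -/
theorem PartitionOfUnityAssumption.exists_cutoff (hPU : Ξ.PartitionOfUnityAssumption) (x₀ : X)
    {r : ℝ} (hr : 0 < r) :
    ∃ ψ : X → ℝ, Ξ.MemSmoothOn (closedBall x₀ r) ψ ∧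
      ∃ δ : ℝ, 0 < δ ∧ ∀ y ∈ closedBall x₀ δ, ψ y = 1 := by
  classical
  obtain ⟨ψ, hψ, -, hsum⟩ := hPU (r / 3) (by positivity)
  obtain ⟨F, hF⟩ := hsum x₀
  -- Dropping the functions that vanish on the ball of radius `r / 3` about `x₀` leaves the sum
  -- there equal to `1`. Each one kept meets that ball and is supported on a ball of diameter at
  -- most `2r / 3`, so its support stays within distance `r` of `x₀`.
  set F' := F.filter fun k => ∃ y ∈ closedBall x₀ (r / 3), ψ k y ≠ 0 with hF'
  refine ⟨fun x => ∑ k ∈ F', ψ k x, ⟨memSmooth_sum _ fun k _ => ?_, fun x hx => ?_⟩,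
    r / 3, by positivity, fun y hy => ?_⟩
  · obtain ⟨y, hy⟩ := hψ k
    exact hy.1
  · refine Finset.sum_eq_zero fun k hk => ?_
    obtain ⟨z, hz⟩ := hψ k
    obtain ⟨-, y, hy, hy0⟩ := Finset.mem_filter.1 hk
    by_contra hx0
    have h1 : x ∈ closedBall z (r / 3) := by_contra fun hc => hx0 (hz.2 x hc)
    have h2 : y ∈ closedBall z (r / 3) := by_contra fun hc => hy0 (hz.2 y hc)
    rw [mem_closedBall] at h1 h2 hy hx
    have h3 := dist_triangle x z x₀
    have h4 := dist_triangle_left z x₀ y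
    linarith
  · rw [← hF y hy]
    refine Finset.sum_subset (Finset.filter_subset _ _) fun k hk hk' => ?_
    by_contra h0
    exact hk' (Finset.mem_filter.2 ⟨hk, y, hy, h0⟩)

end Smooth

/-! ### From smoothness to rates of approximation. -/

/-- Global smoothness gives a rate for `σ_{2^n}`. -/
theorem HeatBound.exists_mul_eLpNorm_sub_sigma_le {q κ κ₁ κ₂ : ℝ} (H : Ξ.HeatBound q κ κ₁ κ₂)
    {h : ℝ → ℝ} (hh : IsLowPass h) (γ : ℝ) :
    ∃ C : ℝ, 0 < C ∧ ∀ (n : ℕ) (p : ℝ≥0∞), 1 ≤ p → ∀ f : X → ℝ, MemLp f p Ξ.μ →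
      ENNReal.ofReal (2 ^ ((n : ℝ) * γ)) *
          eLpNorm (fun x => f x - Ξ.sigma h (2 ^ n) f x) p Ξ.μ ≤
        ENNReal.ofReal C * Ξ.sobolevNorm γ p (fun _ => 1) f := by
  obtain ⟨C, hC, hI⟩ := H.exists_eLpNorm_sub_sigma_le hh
  refine ⟨C * 2 ^ γ, by positivity, fun n p hp f hf => ?_⟩
  -- Near-best approximation refers to the degree `2^n / 2`; the halving costs `2^γ`.
  have e : (2 : ℝ) ^ ((n : ℝ) * γ) = 2 ^ γ * (2 ^ n / 2) ^ γ := by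
    rw [← Real.mul_rpow zero_le_two (by positivity), ← two_pow_rpow]
    congr 1; ring
  calc _ ≤ ENNReal.ofReal (2 ^ ((n : ℝ) * γ)) *
        (ENNReal.ofReal C * Ξ.degApprox (fun _ => 1) (2 ^ n / 2) p f) := by
        gcongr ENNReal.ofReal _ * ?_
        exact hI _ (one_le_pow₀ one_le_two) p hp f hf
    _ = ENNReal.ofReal (C * 2 ^ γ) * (ENNReal.ofReal ((2 ^ n / 2) ^ γ) *
        Ξ.degApprox (fun _ => 1) (2 ^ n / 2) p f) := by
        rw [e, ENNReal.ofReal_mul (by positivity), ENNReal.ofReal_mul hC.le]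
        ring
    _ ≤ _ := by
        gcongr ENNReal.ofReal _ * ?_
        exact le_add_left (le_iSup₂ (f := fun (n : ℝ) (_ : 0 < n) => ENNReal.ofReal (n ^ γ) *
          Ξ.degApprox (fun _ => 1) n p f) (2 ^ n / 2) (by positivity))

/-- Local smoothness implies a local rate of approximation. -/
theorem MemLocalSobolev.exists_errorRate_lt_top {h : ℝ → ℝ} (hh : IsLowPass h)
    (hPU : Ξ.PartitionOfUnityAssumption) {γ : ℝ} {p : ℝ≥0∞} (hp : 1 ≤ p)
    {f : X → ℝ} (hf : MemLp f p Ξ.μ) {x₀ : X} (hloc : Ξ.MemLocalSobolev γ p (fun _ => 1) x₀ f) :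
    ∃ r : ℝ, 0 < r ∧ Ξ.errorRate h γ p (closedBall x₀ r) f < ⊤ := by
  obtain ⟨q, κ, κ₁, κ₂, H⟩ := Ξ.exists_heatBound
  obtain ⟨r, hr, hψf⟩ := hloc
  obtain ⟨ψ, hψ, δ, hδ, hone⟩ := hPU.exists_cutoff x₀ hr
  obtain ⟨hm, hnorm⟩ := hψf ψ hψ
  obtain ⟨C₁, hC₁, hI₁⟩ := H.exists_mul_eLpNorm_sub_sigma_le hh γ
  -- Far-field decay of order at least `γ` is what cancels the weight `2^(nγ)`.
  set S := ⌈γ⌉₊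
  obtain ⟨C₂, hC₂, hI₂⟩ := H.exists_eLpNorm_sigma_le hh S
  set g : X → ℝ := fun x => f x - ψ x * f x with hg
  have hgm : MemLp g p Ξ.μ := hf.sub hm
  -- `g` vanishes on the ball of radius `δ`, so seen from the ball of radius `δ / 2` its values lie
  -- at distance at least `ε`.
  set ε := δ / 2 with hε
  have hε0 : 0 < ε := by positivity
  set N := Ξ.sobolevNorm γ p (fun _ => 1) (fun x => ψ x * f x)
  refine ⟨ε, hε0, lt_of_le_of_lt (b := ENNReal.ofReal C₁ * N +
    ENNReal.ofReal (C₂ * (ε ^ S)⁻¹) * eLpNorm g p Ξ.μ) (iSup_le fun n => ?_) ?_⟩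
  · have hn1 : (1 : ℝ) ≤ 2 ^ n := one_le_pow₀ one_le_two
    have hn0 : (0 : ℝ) < 2 ^ n := by positivity
    have hball : MeasurableSet (closedBall x₀ ε) := isClosed_closedBall.measurableSet
    have split : Ξ.normOn p (closedBall x₀ ε) (fun x => f x - Ξ.sigma h (2 ^ n) f x) ≤
        eLpNorm (fun x => ψ x * f x - Ξ.sigma h (2 ^ n) (fun x => ψ x * f x) x) p Ξ.μ +
        ENNReal.ofReal (C₂ * ((1 + 2 ^ n * ε) ^ S)⁻¹) * eLpNorm g p Ξ.μ := by
      have e : (fun x => f x - Ξ.sigma h (2 ^ n) f x) =ᵐ[Ξ.μ.restrict (closedBall x₀ ε)]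
          (fun x => ψ x * f x - Ξ.sigma h (2 ^ n) (fun x => ψ x * f x) x) -
            Ξ.sigma h (2 ^ n) g := by
        filter_upwards [ae_restrict_mem hball] with x hx
        simp only [Pi.sub_apply]
        rw [hg, sigma_sub hh hn0 hp hf hm, hone x (closedBall_subset_closedBall (by linarith) hx)]
        ring
      rw [normOn, eLpNorm_congr_ae e]
      refine (eLpNorm_sub_le (aestronglyMeasurable_sub_sigma _ hh hm hn0)
        (measurable_sigma hh hn0 _).aestronglyMeasurable hp).trans (add_le_add ?_ ?_)
      · exact eLpNorm_mono_measure _ Measure.restrict_le_self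
      · refine hI₂ _ hn1 ε hε0.le p hp g hgm _ hball fun x hx y hxy => ?_
        have : y ∈ closedBall x₀ δ := by
          rw [mem_closedBall] at hx ⊢
          have := dist_triangle_left y x₀ x
          linarith
        rw [hg]
        simp only
        rw [hone y this]
        ring
    calc _ ≤ ENNReal.ofReal (2 ^ ((n : ℝ) * γ)) *
          (eLpNorm (fun x => ψ x * f x - Ξ.sigma h (2 ^ n) (fun x => ψ x * f x) x) p Ξ.μ +
          ENNReal.ofReal (C₂ * ((1 + 2 ^ n * ε) ^ S)⁻¹) * eLpNorm g p Ξ.μ) := by gcongr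
      _ = ENNReal.ofReal (2 ^ ((n : ℝ) * γ)) *
            eLpNorm (fun x => ψ x * f x - Ξ.sigma h (2 ^ n) (fun x => ψ x * f x) x) p Ξ.μ +
          (ENNReal.ofReal (2 ^ ((n : ℝ) * γ)) * ENNReal.ofReal (C₂ * ((1 + 2 ^ n * ε) ^ S)⁻¹)) *
            eLpNorm g p Ξ.μ := by ring
      _ ≤ _ := by
          gcongr ?_ + ?_ * _
          · exact hI₁ n p hp _ hm
          · rw [← ENNReal.ofReal_mul (by positivity)]
            apply ENNReal.ofReal_le_ofReal
            have h1 : (2 : ℝ) ^ ((n : ℝ) * γ) ≤ (2 ^ n) ^ S := by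
              rw [← two_pow_rpow, ← Real.rpow_natCast _ S]
              exact Real.rpow_le_rpow_of_exponent_le hn1 (Nat.le_ceil γ)
            calc _ ≤ (2 ^ n) ^ S * (C₂ * ((2 ^ n * ε) ^ S)⁻¹) := by
                  gcongr
                  linarith
              _ = _ := by rw [mul_pow]; field_simp
  · exact ENNReal.add_lt_top.2
      ⟨ENNReal.mul_lt_top ENNReal.ofReal_lt_top hnorm,
        ENNReal.mul_lt_top ENNReal.ofReal_lt_top hgm.2⟩

end DataSpace

/-! ### Polynomial growth of `Π_n` and dyadic criteria. -/

namespace DataSpace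

variable {X : Type*} [MetricSpace X] [MeasurableSpace X] {Ξ : DataSpace X}

theorem tsum_lam_lt_eq_sum (Ξ : DataSpace X) (n : ℝ) (x : X) :
    (∑' k, if Ξ.lam k < n then Ξ.φ k x ^ 2 else 0) = ∑ k ∈ Ξ.idx n, Ξ.φ k x ^ 2 := by
  rw [tsum_eq_sum (s := Ξ.idx n) fun k hk => if_neg (mem_idx.not.1 hk)]
  exact Finset.sum_congr rfl fun k hk => if_pos (mem_idx.1 hk)

/-- The Christoffel function bound. -/
theorem HeatBound.sum_sq_le {q κ κ₁ κ₂ : ℝ} (H : Ξ.HeatBound q κ κ₁ κ₂) {n : ℝ} (hn : 1 ≤ n)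
    (x : X) : ∑ k ∈ Ξ.idx n, Ξ.φ k x ^ 2 ≤ Real.exp 1 * κ₁ * n ^ q := by
  have hn0 : 0 < n := by linarith
  have hs : 0 < (n ^ 2)⁻¹ := by positivity
  calc ∑ k ∈ Ξ.idx n, Ξ.φ k x ^ 2
      ≤ ∑ k ∈ Ξ.idx n, Real.exp 1 *
          (Real.exp (-(Ξ.lam k) ^ 2 * (n ^ 2)⁻¹) * |Ξ.φ k x| * |Ξ.φ k x|) := by
        refine Finset.sum_le_sum fun k hk => ?_
        have h1 : (Ξ.lam k) ^ 2 * (n ^ 2)⁻¹ ≤ 1 := by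
          rw [← div_eq_mul_inv, ← div_pow]
          exact pow_le_one₀ (div_nonneg (Ξ.lam_nonneg k) hn0.le)
            ((div_le_one hn0).2 (mem_idx.1 hk).le)
        -- For `λ_k < n` the heat factor at time `n⁻²` is at least `e⁻¹`, so inserting it costs only
        -- `e`.
        have h2 : 1 ≤ Real.exp 1 * Real.exp (-(Ξ.lam k) ^ 2 * (n ^ 2)⁻¹) := by
          rw [← Real.exp_add]
          exact Real.one_le_exp (by linarith)
        calc Ξ.φ k x ^ 2 ≤ Real.exp 1 * Real.exp (-(Ξ.lam k) ^ 2 * (n ^ 2)⁻¹) * Ξ.φ k x ^ 2 :=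
              le_mul_of_one_le_left (sq_nonneg _) h2
          _ = _ := by rw [← sq_abs (Ξ.φ k x)]; ring
    _ = Real.exp 1 * ∑ k ∈ Ξ.idx n,
          Real.exp (-(Ξ.lam k) ^ 2 * (n ^ 2)⁻¹) * |Ξ.φ k x| * |Ξ.φ k x| :=
        (Finset.mul_sum _ _ _).symm
    _ ≤ Real.exp 1 * Ξ.heatAbs (n ^ 2)⁻¹ x x := by
        gcongr
        exact (H.summable_abs hs x x).sum_le_tsum _ fun k _ => by positivity
    _ ≤ Real.exp 1 * (κ₁ * n ^ q) := by
        gcongr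
        exact (H.heatAbs_le hs (inv_sq_le_one hn) x x).trans_eq (by rw [rpow_inv_sq hn0])
    _ = _ := by ring

theorem HeatBound.measure_le_of_diam_le {q κ κ₁ κ₂ : ℝ} (H : Ξ.HeatBound q κ κ₁ κ₂) {K : Set X}
    (hK : IsCompact K) {d : ℝ} (hd : 0 < d) (h : diam K ≤ d) :
    Ξ.μ K ≤ ENNReal.ofReal (κ * d ^ q) := by
  rcases K.eq_empty_or_nonempty with rfl | ⟨y, hy⟩
  · simp
  · refine (measure_mono fun x hx => ?_).trans (H.measure_closedBall_le y d hd)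
    exact (dist_le_diam_of_mem hK.isBounded hx hy).trans h

/-- The dimension of `Π_n` and the norms of its basis elements grow at most polynomially. -/
theorem exists_polynomial_bounds [BorelSpace X] (Ξ : DataSpace X) :
    ∃ (C : ℝ) (M : ℕ), 0 < C ∧ ∀ᶠ n : ℕ in atTop, ((Ξ.idx n).card : ℝ≥0∞) ≤
      ENNReal.ofReal (C * n ^ M) ∧ ∀ k ∈ Ξ.idx n, max (eLpNorm (fun x => Ξ.φ k x) 1 Ξ.μ)
        (eLpNorm (fun x => Ξ.φ k x) ⊤ Ξ.μ) ≤ ENNReal.ofReal (C * n ^ M) := by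
  obtain ⟨q, κ, κ₁, κ₂, H⟩ := Ξ.exists_heatBound
  obtain ⟨K, hKc, ⟨c₁, c₂, hc₁, hc₂, hdiam⟩, -, hint⟩ := Ξ.essentially_compact
  have hκ := H.κ_pos
  have hκ₁ := H.κ₁_pos
  have hq := H.one_le_q
  have hpow : ∀ (s : ℝ) (n : ℕ), 1 ≤ n → (n : ℝ) ^ s ≤ (n : ℝ) ^ ⌈s⌉₊ := fun s n hn => by
    rw [← Real.rpow_natCast]
    exact Real.rpow_le_rpow_of_exponent_le (by exact_mod_cast hn) (Nat.le_ceil s)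
  set a := Real.exp 1 * κ₁ with ha
  set b := κ * c₁ ^ q with hb
  have ha0 : 0 < a := by positivity
  have hb0 : 0 < b := by positivity
  refine ⟨(1 + a) * (1 + b), ⌈q⌉₊ + ⌈c₂ * q⌉₊, by positivity, ?_⟩
  -- Fast decrease is needed here only to bound the integral of `√D` off `K n` by `1`.
  have hev := (hint 1 one_pos).eventually_le_const zero_lt_one
  filter_upwards [hev, eventually_ge_atTop 1] with n hn hn1
  have hn1' : (1 : ℝ) ≤ n := by exact_mod_cast hn1
  have hn0 : (0 : ℝ) < n := by linarith
  set D : X → ℝ := fun x => ∑ k ∈ Ξ.idx n, Ξ.φ k x ^ 2 with hD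
  have hD0 : ∀ x, 0 ≤ D x := fun x => Finset.sum_nonneg fun k _ => sq_nonneg _
  simp only [tsum_lam_lt_eq_sum] at hn
  have hfar : ∫⁻ x in (K n)ᶜ, ENNReal.ofReal (√(D x)) ∂Ξ.μ ≤ 1 := by
    refine le_trans ?_ hn
    rw [Real.rpow_one]
    exact le_mul_of_one_le_left zero_le (by simpa using hn1')
  have hDle : ∀ x, D x ≤ a * n ^ q := fun x => H.sum_sq_le hn1' x
  have hsqrt : ∀ x, √(D x) ≤ 1 + a * n ^ q := fun x =>
    (Real.sqrt_le_left (by positivity)).2 (by nlinarith [hDle x, hD0 x])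
  have hKm : MeasurableSet (K n) := (hKc n hn1).isClosed.measurableSet
  have hμK : Ξ.μ (K n) ≤ ENNReal.ofReal (b * n ^ (c₂ * q)) := by
    refine (H.measure_le_of_diam_le (hKc n hn1) (by positivity) (hdiam n hn1)).trans_eq ?_
    rw [Real.mul_rpow hc₁.le (by positivity), ← Real.rpow_mul hn0.le, ← mul_assoc]
  set U := 1 + a * (n : ℝ) ^ q with hU
  set V := b * (n : ℝ) ^ (c₂ * q) with hV
  have hU1 : 1 ≤ U := by
    have : 0 ≤ a * (n : ℝ) ^ q := by positivity
    linarith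
  have hV0 : 0 ≤ V := by positivity
  have hbound : U * V + U ≤ (1 + a) * (1 + b) * n ^ (⌈q⌉₊ + ⌈c₂ * q⌉₊) := by
    have h1 : U ≤ (1 + a) * (n : ℝ) ^ ⌈q⌉₊ := by
      rw [hU, add_mul, one_mul]
      gcongr
      · exact one_le_pow₀ hn1'
      · exact hpow q n hn1
    have h2 : V + 1 ≤ (1 + b) * (n : ℝ) ^ ⌈c₂ * q⌉₊ := by
      rw [hV, add_mul, one_mul, add_comm]
      gcongr
      · exact one_le_pow₀ hn1'
      · exact hpow _ n hn1
    calc U * V + U = U * (V + 1) := by ring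
      _ ≤ ((1 + a) * (n : ℝ) ^ ⌈q⌉₊) * ((1 + b) * (n : ℝ) ^ ⌈c₂ * q⌉₊) := by gcongr
      _ = _ := by rw [pow_add]; ring
  have hφD : ∀ k ∈ Ξ.idx n, ∀ x, |Ξ.φ k x| ≤ √(D x) := fun k hk x => by
    rw [← Real.sqrt_sq_eq_abs]
    exact Real.sqrt_le_sqrt (Finset.single_le_sum (f := fun k => Ξ.φ k x ^ 2)
      (fun k _ => sq_nonneg _) hk)
  refine ⟨?_, fun k hk => max_le ?_ ?_⟩
  -- By orthonormality the dimension is the integral of `D`. On `K n` the bounds on `D` and on the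
  -- measure suffice; off `K n` write `D = √D · √D`, bound one root uniformly and integrate the
  -- other.
  · have h1 : ((Ξ.idx n).card : ℝ≥0∞) = ∫⁻ x, ENNReal.ofReal (D x) ∂Ξ.μ := by
      have h2 : ∀ k, ∫⁻ x, ENNReal.ofReal (Ξ.φ k x ^ 2) ∂Ξ.μ = 1 := by
        intro k
        have hi := integrable_mul_φ le_rfl (Ξ.memLp_φ k le_rfl) k
        simp_rw [pow_two]
        rw [← ofReal_integral_eq_lintegral_ofReal hi
          (Eventually.of_forall fun x => mul_self_nonneg _), Ξ.φ_orthonormal, if_pos rfl,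
          ENNReal.ofReal_one]
      simp only [hD]
      simp_rw [ENNReal.ofReal_sum_of_nonneg fun k _ => sq_nonneg _]
      rw [lintegral_finsetSum _ fun k _ => ((Ξ.measurable_φ k).pow_const 2).ennreal_ofReal]
      simp [h2]
    rw [h1, ← lintegral_add_compl _ hKm]
    refine le_trans ?_ (ENNReal.ofReal_le_ofReal hbound)
    rw [ENNReal.ofReal_add (by positivity) (by positivity)]
    gcongr
    · calc _ ≤ ∫⁻ x in K n, ENNReal.ofReal U ∂Ξ.μ := by
            refine lintegral_mono fun x => ENNReal.ofReal_le_ofReal ?_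
            linarith [hDle x]
        _ = ENNReal.ofReal U * Ξ.μ (K n) := setLIntegral_const _ _
        _ ≤ ENNReal.ofReal U * ENNReal.ofReal V := by gcongr
        _ = _ := (ENNReal.ofReal_mul (by positivity)).symm
    · calc _ ≤ ∫⁻ x in (K n)ᶜ, ENNReal.ofReal U * ENNReal.ofReal (√(D x)) ∂Ξ.μ := by
            refine lintegral_mono fun x => ?_
            rw [← ENNReal.ofReal_mul (by positivity)]
            apply ENNReal.ofReal_le_ofReal
            nth_rw 1 [← Real.mul_self_sqrt (hD0 x)]
            gcongr
            exact hsqrt x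
        _ = ENNReal.ofReal U * ∫⁻ x in (K n)ᶜ, ENNReal.ofReal (√(D x)) ∂Ξ.μ :=
            lintegral_const_mul' _ _ ENNReal.ofReal_ne_top
        _ ≤ ENNReal.ofReal U * 1 := by gcongr
        _ = _ := mul_one _
  · rw [eLpNorm_one_eq_lintegral_enorm]
    calc ∫⁻ x, ‖Ξ.φ k x‖ₑ ∂Ξ.μ ≤ ∫⁻ x, ENNReal.ofReal (√(D x)) ∂Ξ.μ := by
          refine lintegral_mono fun x => ?_
          rw [Real.enorm_eq_ofReal_abs]
          exact ENNReal.ofReal_le_ofReal (hφD k hk x)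
      _ = ∫⁻ x in K n, ENNReal.ofReal (√(D x)) ∂Ξ.μ +
          ∫⁻ x in (K n)ᶜ, ENNReal.ofReal (√(D x)) ∂Ξ.μ := (lintegral_add_compl _ hKm).symm
      _ ≤ ENNReal.ofReal U * ENNReal.ofReal V + 1 := by
          gcongr
          calc _ ≤ ∫⁻ x in K n, ENNReal.ofReal U ∂Ξ.μ :=
                lintegral_mono fun x => ENNReal.ofReal_le_ofReal (hsqrt x)
            _ = ENNReal.ofReal U * Ξ.μ (K n) := setLIntegral_const _ _
            _ ≤ _ := by gcongr
      _ = ENNReal.ofReal (U * V + 1) := by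
          rw [← ENNReal.ofReal_mul (by positivity), ENNReal.ofReal_add (by positivity) zero_le_one,
            ENNReal.ofReal_one]
      _ ≤ _ := ENNReal.ofReal_le_ofReal (by linarith)
  · rw [eLpNorm_exponent_top]
    refine essSup_le_of_ae_le _ (Eventually.of_forall fun x => ?_)
    change ‖Ξ.φ k x‖ₑ ≤ _
    rw [Real.enorm_eq_ofReal_abs]
    apply ENNReal.ofReal_le_ofReal
    calc _ ≤ U := (hφD k hk x).trans (hsqrt x)
      _ ≤ U * V + U := by nlinarith
      _ ≤ _ := hbound

theorem diffPoly_mono {m n : ℝ} (h : m ≤ n) : Ξ.diffPoly m ≤ Ξ.diffPoly n :=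
  Submodule.span_mono fun _ ⟨k, hk, hg⟩ => ⟨k, hk.trans_le h, hg⟩

theorem degApprox_antitone (w : X → ℝ) (p : ℝ≥0∞) (f : X → ℝ) {m n : ℝ} (h : m ≤ n) :
    Ξ.degApprox w n p f ≤ Ξ.degApprox w m p f :=
  le_iInf₂ fun P hP => iInf₂_le P (diffPoly_mono h hP)

/-- A rate along `A 2^j` for all large `j` gives the smoothness condition for all degrees. -/
theorem memSobolev_of_dyadic {w : X → ℝ} {p : ℝ≥0∞} {f : X → ℝ} (hf : MemLp f p Ξ.μ) {γ : ℝ}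
    (hγ : 0 < γ) {A : ℝ} (hA : 0 < A) {C : ℝ≥0∞} (hC : C < ⊤) {j₀ : ℕ}
    (h : ∀ j, j₀ ≤ j → ENNReal.ofReal (2 ^ ((j : ℝ) * γ)) * Ξ.degApprox w (A * 2 ^ j) p f ≤ C) :
    Ξ.MemSobolev γ p w f := by
  refine ⟨hf, ENNReal.add_lt_top.2 ⟨hf.2, lt_of_le_of_lt
    (b := ENNReal.ofReal ((A * 2 ^ j₀) ^ γ) * eLpNorm f p Ξ.μ + ENNReal.ofReal ((2 * A) ^ γ) * C)
    (iSup₂_le fun m hm => ?_) ?_⟩⟩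
  -- Below the threshold `P = 0` is good enough. Above it, `m` lies within a factor `2` of some `A
  -- 2^j` with `j ≥ j₀`, which accounts for `(2A)^γ`.
  · rcases lt_or_ge m (A * 2 ^ j₀) with hlt | hge
    · refine le_add_right ?_
      gcongr
      exact (iInf₂_le 0 (zero_mem _)).trans_eq (by simp)
    · refine le_add_left ?_
      obtain ⟨i, hi₁, hi₂⟩ := exists_nat_pow_near (x := m / (A * 2 ^ j₀))
        ((one_le_div (by positivity)).2 hge) one_lt_two
      rw [le_div_iff₀ (by positivity)] at hi₁
      rw [div_lt_iff₀ (by positivity)] at hi₂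
      have e : A * 2 ^ (j₀ + i) = 2 ^ i * (A * 2 ^ j₀) := by rw [pow_add]; ring
      have hm2 : m ^ γ ≤ (2 * A) ^ γ * 2 ^ (((j₀ + i : ℕ) : ℝ) * γ) := by
        rw [← two_pow_rpow, ← Real.mul_rpow (by positivity) (by positivity)]
        refine Real.rpow_le_rpow hm.le ?_ hγ.le
        rw [mul_assoc, e]
        exact hi₂.le.trans_eq (by ring)
      calc _ ≤ ENNReal.ofReal ((2 * A) ^ γ * 2 ^ (((j₀ + i : ℕ) : ℝ) * γ)) *
            Ξ.degApprox w (A * 2 ^ (j₀ + i)) p f := by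
            refine mul_le_mul' (ENNReal.ofReal_le_ofReal hm2) (degApprox_antitone w p f ?_)
            rw [e]; exact hi₁
        _ = ENNReal.ofReal ((2 * A) ^ γ) * (ENNReal.ofReal (2 ^ (((j₀ + i : ℕ) : ℝ) * γ)) *
            Ξ.degApprox w (A * 2 ^ (j₀ + i)) p f) := by
            rw [ENNReal.ofReal_mul (by positivity), mul_assoc]
        _ ≤ _ := by
            gcongr ENNReal.ofReal _ * ?_
            exact h _ (Nat.le_add_right _ _)
  · exact ENNReal.add_lt_top.2 ⟨ENNReal.mul_lt_top ENNReal.ofReal_lt_top hf.2,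
      ENNReal.mul_lt_top ENNReal.ofReal_lt_top hC⟩

/-! ### Products of diffusion polynomials, and from rates to local smoothness. -/

variable [BorelSpace X]

theorem enorm_lowPass_mul_coeff_le {h : ℝ → ℝ} (hh : IsLowPass h) (t : ℝ) {p : ℝ≥0∞} (hp : 1 ≤ p)
    {f : X → ℝ} (hf : MemLp f p Ξ.μ) (k : ℕ) :
    ‖h t * Ξ.coeff f k‖ₑ ≤ eLpNorm f p Ξ.μ *
      max (eLpNorm (fun x => Ξ.φ k x) 1 Ξ.μ) (eLpNorm (fun x => Ξ.φ k x) ⊤ Ξ.μ) := by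
  rw [enorm_mul]
  refine (mul_le_of_le_one_left zero_le ?_).trans (enorm_coeff_le hp hf k)
  rw [Real.enorm_eq_ofReal_abs, ENNReal.ofReal_le_one, abs_of_nonneg (hh.mem_Icc t).1]
  exact (hh.mem_Icc t).2

/-- Products `σ_n(g) σ_n(f)` are approximated by `φ_0 Π_{An}` at every polynomial rate. -/
theorem ProductAssumption.exists_approx_sigma_mul_sigma (hprod : Ξ.ProductAssumption) {h : ℝ → ℝ}
    (hh : IsLowPass h) :
    ∃ A : ℝ, 1 ≤ A ∧ ∀ γ : ℝ, 0 < γ → ∃ C : ℝ, ∀ᶠ n : ℕ in atTop, ∀ (p : ℝ≥0∞), 1 ≤ p →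
      ∀ f g : X → ℝ, MemLp f p Ξ.μ → MemLp g ⊤ Ξ.μ → ∃ P ∈ Ξ.diffPoly (A * n),
        ENNReal.ofReal ((n : ℝ) ^ γ) *
          eLpNorm (fun x => Ξ.sigma h n g x * Ξ.sigma h n f x - P x * Ξ.φ 0 x) p Ξ.μ ≤
        ENNReal.ofReal C * (eLpNorm g ⊤ Ξ.μ * eLpNorm f p Ξ.μ) := by
  obtain ⟨A, hA, R, hR, hfast⟩ := hprod
  obtain ⟨C, M, hC, hpoly⟩ := Ξ.exists_polynomial_bounds
  refine ⟨A, hA, fun γ hγ => ⟨C ^ 4, ?_⟩⟩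
  -- Four polynomial factors must be absorbed besides `n^γ`: the number of indices twice, and one
  -- coefficient bound for each of `f` and `g`.
  have hev := (hfast (γ + (4 * M : ℕ)) (by positivity)).eventually_le_const zero_lt_one
  filter_upwards [hpoly, hev, eventually_ge_atTop 1] with n ⟨hcard, hφ⟩ hε hn1 p hp f g hf hg
  have hn0 : (0 : ℝ) < n := by exact_mod_cast hn1
  set c : ℕ → ℝ := fun j => h (Ξ.lam j / n) * Ξ.coeff g j with hc
  set d : ℕ → ℝ := fun k => h (Ξ.lam k / n) * Ξ.coeff f k with hd
  set E : ℕ → ℕ → X → ℝ := fun j k x => Ξ.φ k x * Ξ.φ j x - R j k n x * Ξ.φ 0 x with hE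
  set ε := ⨆ (j : ℕ) (k : ℕ) (_ : Ξ.lam j < n) (_ : Ξ.lam k < n),
    max (eLpNorm (E j k) 1 Ξ.μ) (eLpNorm (E j k) ⊤ Ξ.μ) with hεdef
  set B := ENNReal.ofReal (C * n ^ M) with hB
  set G := eLpNorm g ⊤ Ξ.μ
  set F := eLpNorm f p Ξ.μ
  have hEm : ∀ j k, AEStronglyMeasurable (E j k) Ξ.μ := fun j k =>
    ((Ξ.measurable_φ k).mul (Ξ.measurable_φ j)).aestronglyMeasurable.sub
      ((memLp_of_mem_diffPoly (hR j k n) le_rfl).1.mul (Ξ.measurable_φ 0).aestronglyMeasurable)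
  have hEle : ∀ j ∈ Ξ.idx n, ∀ k ∈ Ξ.idx n, eLpNorm (E j k) p Ξ.μ ≤ ε := by
    intro j hj k hk
    refine (eLpNorm_le_max_one_top hp (hEm j k)).trans ?_
    exact le_iSup_of_le j (le_iSup_of_le k (le_iSup_of_le (mem_idx.1 hj)
      (le_iSup_of_le (mem_idx.1 hk) le_rfl)))
  have hcle : ∀ j ∈ Ξ.idx n, ‖c j‖ₑ ≤ G * B := fun j hj =>
    (enorm_lowPass_mul_coeff_le hh _ le_top hg j).trans (by gcongr; exact hφ j hj)
  have hdle : ∀ k ∈ Ξ.idx n, ‖d k‖ₑ ≤ F * B := fun k hk =>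
    (enorm_lowPass_mul_coeff_le hh _ hp hf k).trans (by gcongr; exact hφ k hk)
  refine ⟨∑ j ∈ Ξ.idx n, ∑ k ∈ Ξ.idx n, (c j * d k) • R j k n,
    Submodule.sum_mem _ fun j _ => Submodule.sum_mem _ fun k _ =>
      Submodule.smul_mem _ _ (hR j k n), ?_⟩
  have e : (fun x => Ξ.sigma h n g x * Ξ.sigma h n f x -
      (∑ j ∈ Ξ.idx n, ∑ k ∈ Ξ.idx n, (c j * d k) • R j k n) x * Ξ.φ 0 x) =
      ∑ j ∈ Ξ.idx n, ∑ k ∈ Ξ.idx n, (c j * d k) • E j k := by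
    ext x
    rw [Ξ.sigma_eq_sum hh hn0, Ξ.sigma_eq_sum hh hn0, Finset.sum_mul_sum]
    simp only [Finset.sum_apply, Pi.smul_apply, smul_eq_mul, Finset.sum_mul,
      ← Finset.sum_sub_distrib]
    refine Finset.sum_congr rfl fun j _ => Finset.sum_congr rfl fun k _ => ?_
    simp only [hE, hc, hd]
    ring
  have hsum : eLpNorm (∑ j ∈ Ξ.idx n, ∑ k ∈ Ξ.idx n, (c j * d k) • E j k) p Ξ.μ ≤
      B * (B * (G * B * (F * B) * ε)) := by
    have hm : ∀ j k, AEStronglyMeasurable ((c j * d k) • E j k) Ξ.μ :=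
      fun j k => (hEm j k).const_smul _
    calc _ ≤ ∑ j ∈ Ξ.idx n, ∑ k ∈ Ξ.idx n, eLpNorm ((c j * d k) • E j k) p Ξ.μ := by
          refine (eLpNorm_sum_le (fun j _ => Finset.aestronglyMeasurable_sum _ fun k _ => hm j k)
            hp).trans (Finset.sum_le_sum fun j _ => eLpNorm_sum_le (fun k _ => hm j k) hp)
      _ ≤ ∑ j ∈ Ξ.idx n, ∑ k ∈ Ξ.idx n, G * B * (F * B) * ε := by
          refine Finset.sum_le_sum fun j hj => Finset.sum_le_sum fun k hk => ?_
          rw [eLpNorm_const_smul, enorm_mul]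
          gcongr
          · exact hcle j hj
          · exact hdle k hk
          · exact hEle j hj k hk
      _ = (Ξ.idx n).card * ((Ξ.idx n).card * (G * B * (F * B) * ε)) := by
          simp only [Finset.sum_const, nsmul_eq_mul]
      _ ≤ _ := by gcongr
  have hpow : ENNReal.ofReal ((n : ℝ) ^ γ) * B ^ 4 =
      ENNReal.ofReal (C ^ 4) * ENNReal.ofReal ((n : ℝ) ^ (γ + (4 * M : ℕ))) := by
    rw [hB, ← ENNReal.ofReal_pow (by positivity), ← ENNReal.ofReal_mul (by positivity),
      ← ENNReal.ofReal_mul (by positivity), Real.rpow_add hn0, Real.rpow_natCast]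
    congr 1
    ring
  rw [e]
  calc _ ≤ ENNReal.ofReal ((n : ℝ) ^ γ) * (B * (B * (G * B * (F * B) * ε))) := by gcongr
    _ = (ENNReal.ofReal ((n : ℝ) ^ γ) * B ^ 4) * ε * (G * F) := by ring
    _ = ENNReal.ofReal (C ^ 4) * (ENNReal.ofReal ((n : ℝ) ^ (γ + (4 * M : ℕ))) * ε) * (G * F) := by
        rw [hpow]; ring
    _ ≤ ENNReal.ofReal (C ^ 4) * 1 * (G * F) := by gcongr
    _ = _ := by rw [mul_one]

/-- A local rate of approximation implies local smoothness with weight `φ_0`. -/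
theorem memLocalSobolev_of_errorRate_lt_top {h : ℝ → ℝ} (hh : IsLowPass h)
    (hprod : Ξ.ProductAssumption) {γ : ℝ} (hγ : 0 < γ) {p : ℝ≥0∞} (hp : 1 ≤ p) {f : X → ℝ}
    (hf : MemLp f p Ξ.μ) {x₀ : X} {r : ℝ} (hr : 0 < r)
    (hrate : Ξ.errorRate h γ p (closedBall x₀ r) f < ⊤) :
    Ξ.MemLocalSobolev γ p (fun x => Ξ.φ 0 x) x₀ f := by
  obtain ⟨q, κ, κ₁, κ₂, H⟩ := Ξ.exists_heatBound
  obtain ⟨A, hA, hAγ⟩ := hprod.exists_approx_sigma_mul_sigma hh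
  obtain ⟨C₃, hC₃⟩ := hAγ γ hγ
  obtain ⟨C₁, hC₁, hI₁⟩ := H.exists_mul_eLpNorm_sub_sigma_le hh γ
  obtain ⟨C₂, hC₂, hI₂⟩ := H.exists_eLpNorm_sigma_le_mul hh
  obtain ⟨n₀, hn₀⟩ := eventually_atTop.1 hC₃
  refine ⟨r, hr, fun ψ hψ => ?_⟩
  obtain ⟨hψm, hψN⟩ := hψ.1 γ hγ
  set G := eLpNorm ψ ⊤ Ξ.μ
  set F := eLpNorm f p Ξ.μ
  set ρ := Ξ.errorRate h γ p (closedBall x₀ r) f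
  set N := Ξ.sobolevNorm γ ⊤ (fun _ => 1) ψ
  have hψf : MemLp (fun x => ψ x * f x) p Ξ.μ := hf.mul hψm
  refine memSobolev_of_dyadic hψf hγ (by linarith : 0 < A) (j₀ := n₀)
    (C := G * ρ + ENNReal.ofReal C₁ * N * (ENNReal.ofReal C₂ * F) +
      ENNReal.ofReal C₃ * (G * F)) ?_ fun j hj => ?_
  · exact ENNReal.add_lt_top.2 ⟨ENNReal.add_lt_top.2 ⟨ENNReal.mul_lt_top hψm.2 hrate,
      ENNReal.mul_lt_top (ENNReal.mul_lt_top ENNReal.ofReal_lt_top hψN)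
        (ENNReal.mul_lt_top ENNReal.ofReal_lt_top hf.2)⟩,
      ENNReal.mul_lt_top ENNReal.ofReal_lt_top (ENNReal.mul_lt_top hψm.2 hf.2)⟩
  · have hj0 : (0 : ℝ) < 2 ^ j := by positivity
    have hj1 : (1 : ℝ) ≤ 2 ^ j := one_le_pow₀ one_le_two
    -- The estimate is stated for integers `n ≥ n₀`, and `2^j > j ≥ n₀`.
    obtain ⟨P, hP, hPle⟩ := hn₀ (2 ^ j) (hj.trans Nat.lt_two_pow_self.le) p hp f ψ hf hψm
    push_cast at hP hPle
    rw [two_pow_rpow] at hPle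
    set W := ENNReal.ofReal (2 ^ ((j : ℝ) * γ)) with hW
    set σf := Ξ.sigma h (2 ^ j) f with hσf
    set σψ := Ξ.sigma h (2 ^ j) ψ with hσψ
    have hσfm : Measurable σf := measurable_sigma hh hj0 f
    have hσψm : Measurable σψ := measurable_sigma hh hj0 ψ
    -- As `ψ` vanishes off the ball, the indicator changes nothing in the product, but it lets the
    -- first term be bounded by the local error alone. The second term is measured by the global
    -- `L^∞` error of `ψ`, the third by the product assumption.
    set u : X → ℝ := ψ • (closedBall x₀ r).indicator fun x => f x - σf x with hu
    set v : X → ℝ := (fun x => ψ x - σψ x) • σf with hv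
    set z : X → ℝ := fun x => σψ x * σf x - P x * Ξ.φ 0 x with hz
    have hball : MeasurableSet (closedBall x₀ r) := isClosed_closedBall.measurableSet
    have hfσ : AEStronglyMeasurable (fun x => f x - σf x) Ξ.μ :=
      hf.1.sub hσfm.aestronglyMeasurable
    have hψσ : AEStronglyMeasurable (fun x => ψ x - σψ x) Ξ.μ :=
      hψm.1.sub hσψm.aestronglyMeasurable
    have hum : AEStronglyMeasurable u Ξ.μ := hψm.1.smul (hfσ.indicator hball)
    have hvm : AEStronglyMeasurable v Ξ.μ := hψσ.smul hσfm.aestronglyMeasurable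
    have hzm : AEStronglyMeasurable z Ξ.μ :=
      (hσψm.mul hσfm).aestronglyMeasurable.sub
        ((memLp_of_mem_diffPoly hP hp).1.mul (Ξ.measurable_φ 0).aestronglyMeasurable)
    have hdecomp : (fun x => ψ x * f x - P x * Ξ.φ 0 x) = u + v + z := by
      ext x
      simp only [Pi.add_apply, hu, hv, hz, smul_eq_mul, Pi.mul_apply]
      by_cases hx : x ∈ closedBall x₀ r
      · rw [Set.indicator_of_mem hx]; ring
      · rw [hψ.2 x hx]; ring
    have hule : W * eLpNorm u p Ξ.μ ≤ G * ρ := by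
      calc _ ≤ W * (G * eLpNorm ((closedBall x₀ r).indicator fun x => f x - σf x) p Ξ.μ) := by
            gcongr
            exact eLpNorm_smul_le_eLpNorm_top_mul_eLpNorm p (hfσ.indicator hball) ψ
        _ = G * (W * Ξ.normOn p (closedBall x₀ r) (fun x => f x - σf x)) := by
            rw [eLpNorm_indicator_eq_eLpNorm_restrict hball, normOn]; ring
        _ ≤ _ := by
            gcongr
            exact le_iSup (fun n : ℕ => ENNReal.ofReal ((2 : ℝ) ^ ((n : ℝ) * γ)) *
              Ξ.normOn p (closedBall x₀ r) (fun x => f x - Ξ.sigma h (2 ^ n) f x)) j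
    have hvle : W * eLpNorm v p Ξ.μ ≤ ENNReal.ofReal C₁ * N * (ENNReal.ofReal C₂ * F) := by
      calc _ ≤ W * (eLpNorm (fun x => ψ x - σψ x) ⊤ Ξ.μ * eLpNorm σf p Ξ.μ) := by
            gcongr
            exact eLpNorm_smul_le_eLpNorm_top_mul_eLpNorm p hσfm.aestronglyMeasurable _
        _ = (W * eLpNorm (fun x => ψ x - σψ x) ⊤ Ξ.μ) * eLpNorm σf p Ξ.μ := by ring
        _ ≤ _ := mul_le_mul' (hI₁ j ⊤ le_top ψ hψm) (hI₂ _ hj1 p hp f hf)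
    calc _ ≤ W * eLpNorm (fun x => ψ x * f x - P x * Ξ.φ 0 x) p Ξ.μ := by
          gcongr
          exact iInf₂_le P hP
      _ ≤ W * (eLpNorm u p Ξ.μ + eLpNorm v p Ξ.μ + eLpNorm z p Ξ.μ) := by
          rw [hdecomp]
          gcongr
          exact (eLpNorm_add_le (hum.add hvm) hzm hp).trans
            (add_le_add (eLpNorm_add_le hum hvm hp) le_rfl)
      _ = W * eLpNorm u p Ξ.μ + W * eLpNorm v p Ξ.μ + W * eLpNorm z p Ξ.μ := by ring
      _ ≤ _ := add_le_add (add_le_add hule hvle) hPle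

end DataSpace

end

theorem theorem6p1 {X : Type*} [MetricSpace X] [ConnectedSpace X] [MeasurableSpace X]
    [BorelSpace X] (Ξ : DataSpace X) (h : ℝ → ℝ) (hh : IsLowPass h)
    (hPU : Ξ.PartitionOfUnityAssumption) (hprod : Ξ.ProductAssumption)
    (γ : ℝ) (hγ : 0 < γ) :
    -- Part (a): the two local rates are equivalent, with constants independent of `p, f, x₀, r`.
    (∃ c₁ c₂ : ℝ, 0 < c₁ ∧ 0 < c₂ ∧
      ∀ (p : ℝ≥0∞), 1 ≤ p → ∀ f : X → ℝ, Ξ.MemXp p f → ∀ (x₀ : X) (r : ℝ), 0 < r →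
        (ENNReal.ofReal c₁ * Ξ.errorRate h γ p (closedBall x₀ r) f
            ≤ Ξ.tauRate h γ p (closedBall x₀ r) 1 f ∧
          Ξ.tauRate h γ p (closedBall x₀ r) 1 f
            ≤ ENNReal.ofReal c₂ * Ξ.errorRate h γ p (closedBall x₀ r) f) ∧
        (ENNReal.ofReal c₁ *
            (Ξ.normOn p (closedBall x₀ r) f + Ξ.errorRate h γ p (closedBall x₀ r) f)
            ≤ Ξ.tauRate h γ p (closedBall x₀ r) 0 f ∧
          Ξ.tauRate h γ p (closedBall x₀ r) 0 f
            ≤ ENNReal.ofReal c₂ *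
              (Ξ.normOn p (closedBall x₀ r) f + Ξ.errorRate h γ p (closedBall x₀ r) f))) ∧
    -- Part (b): finiteness of one of the rates on some ball gives local smoothness.
    (∀ (p : ℝ≥0∞), 1 ≤ p → ∀ f : X → ℝ, Ξ.MemXp p f → ∀ x₀ : X,
      (∃ r : ℝ, 0 < r ∧ (Ξ.errorRate h γ p (closedBall x₀ r) f < ⊤ ∨
        Ξ.tauRate h γ p (closedBall x₀ r) 0 f < ⊤)) →
      Ξ.MemLocalSobolev γ p (fun x => Ξ.φ 0 x) x₀ f) ∧
    -- Part (c): local smoothness gives finiteness of both rates on some ball.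
    (∀ (p : ℝ≥0∞), 1 ≤ p → ∀ f : X → ℝ, Ξ.MemXp p f → ∀ x₀ : X,
      Ξ.MemLocalSobolev γ p (fun _ => 1) x₀ f →
      ∃ r : ℝ, 0 < r ∧ Ξ.errorRate h γ p (closedBall x₀ r) f < ⊤ ∧
        Ξ.tauRate h γ p (closedBall x₀ r) 0 f < ⊤) := by
  obtain ⟨c₁, c₂, hc₁, hc₂, hrates⟩ := DataSpace.exists_rate_constants hγ
  have htau : ∀ (p : ℝ≥0∞), 1 ≤ p → ∀ f : X → ℝ, Ξ.MemXp p f → ∀ B : Set X,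
      Ξ.errorRate h γ p B f < ⊤ → Ξ.tauRate h γ p B 0 f < ⊤ := fun p hp f hf B hB =>
    (hrates hh p hp f hf B).2.2.trans_lt (ENNReal.mul_lt_top ENNReal.ofReal_lt_top
      (ENNReal.add_lt_top.2 ⟨(hf.1.restrict B).2, hB⟩))
  refine ⟨⟨c₁, c₂, hc₁, hc₂, fun p hp f hf x₀ r _ => hrates hh p hp f hf _⟩, ?_, ?_⟩
  · rintro p hp f hf x₀ ⟨r, hr, hrate⟩
    refine DataSpace.memLocalSobolev_of_errorRate_lt_top hh hprod hγ hp hf.1 hr ?_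
    refine hrate.elim id fun htop => ?_
    -- The equivalence holds in `[0, ∞]`: since `c₁ > 0`, an infinite error rate would force an
    -- infinite `τ` rate.
    have hle := (hrates hh p hp f hf (closedBall x₀ r)).2.1.trans_lt htop
    by_contra hne
    rw [not_lt_top_iff] at hne
    rw [hne, add_top, ENNReal.mul_top (by simpa using hc₁)] at hle
    exact lt_irrefl _ hle
  · intro p hp f hf x₀ hloc
    obtain ⟨r, hr, herr⟩ := hloc.exists_errorRate_lt_top hh hPU hp hf.1
    exact ⟨r, hr, herr, htau p hp f hf _ herr⟩
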